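/- **Conventions.** A graph $\Gamma$ is a finite one-dimensional cell complex: a finite set $V$ of vertices and a finite set $E$ of edges, each edge $e$ having two ends attached to vertices $e(0),e(1)\in V$ (multiple edges and loops are allowed). For $n\ge 0$ let $\rho_n$ be the irreducible representation of $SU(2)$ of dimension $n+1$ (spin $n$) and $\chi_n=\operatorname{Tr}\rho_n$ its character. For a labelling of the edges by spins $n_e\in\mathbb{Z}_{\ge 0}$ the invariant of $\Gamma$ is $$I_\Gamma\bigl((n_e)_{e\in E}\bigr)=\int_{h\in SU(2)^V}\ \prod_{e\in E}(-1)^{n_e}\,\chi_{n_e}\!\left(h_{e(0)}h_{e(1)}^{-1}\right)\,dh ,$$ where each factor $SU(2)$ carries the Haar measure of total volume $1$. **(1) Contraction formula.** Let $e_0$ be an edge of $\Gamma$ that joins two distinct vertices, and let $\Gamma'$ be obtained from $\Gamma$ by contracting $e_0$ (remove $e_0$ and identify its two ends). Let spins be given on the edges $e\neq e_0$; they label both $\Gamma'$ and, together with a spin $n$ on $e_0$, the graph $\Gamma$. Then $$I_{\Gamma'}=\sum_{n=0}^{\infty}(-1)^n(n+1)\,I_{\Gamma}(n),$$ where $I_\Gamma(n)$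 is the invariant of $\Gamma$ with spin $n$ on $e_0$, and $I_\Gamma(n)\ne 0$ for only finitely many $n$. **(2) Expansion of a vertex as a tree.** Let $\Gamma$ be a graph with a spin on each edge, $v$ a vertex of $\Gamma$ and $T$ a finite tree with edge set $F$. Let $\Gamma_T$ be any graph obtained from $\Gamma$ by replacing $v$ by $T$ and attaching each edge-end that was attached to $v$ to an arbitrarily chosen vertex of $T$. For $m\in\mathbb{Z}_{\ge0}^F$ let $I_{\Gamma_T}(m)$ be the invariant of $\Gamma_T$ with the given spins on the edges of $\Gamma$ and the spins $m_f$ on the edges $f$ of $T$. Then $I_{\Gamma_T}(m)\neq0$ for only finitely many $m$, and $$I_\Gamma=\sum_{m\in\mathbb{Z}_{\ge0}^F}\ \Bigl(\prod_{f\in F}(-1)^{m_f}(m_f+1)\Bigr)\, I_{\Gamma_T}(m).$$ **(3) Character identity.** Let $f\colon SU(2)\times SU(2)\to\mathbb{C}$ be continuous and put $$c_n=(n+1)\int_{SU(2)\times SU(2)} f(g,h)\,\chi_n(gh^{-1})\,dg\,dh .$$ Then $$\lim_{r\to1^-}\sum_{n=0}^\infty c_n r^n=\int_{SU(2)}f(h,h)\,dh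 ,$$ and whenever the series $\sum_{n} c_n$ converges, $\sum_{n=0}^{\infty}c_n=\int_{SU(2)}f(h,h)\,dh$. -/

import Mathlib

open MeasureTheory

/-- The group `SU(2)`, with its topology as a subspace of the complex `2 × 2` matrices. -/
abbrev SU2 : Type := Matrix.specialUnitaryGroup (Fin 2) ℂ

namespace SU2

/-- `SU(2)` carries its Borel `σ`-algebra. -/
noncomputable instance : MeasurableSpace SU2 := borel SU2

instance : BorelSpace SU2 := ⟨rfl⟩

instance : IsTopologicalGroup SU2 where
  continuous_inv :=
    Continuous.subtype_mk (Continuous.matrix_conjTranspose continuous_subtype_val) _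

theorem norm_entry_le (g : SU2) (i j : Fin 2) : ‖g.1 i j‖ ≤ 1 :=
  entry_norm_bound_of_unitary g.2.1 i j

instance : CompactSpace SU2 := by
  apply isCompact_iff_compactSpace.mp
  have hK : IsCompact (Set.pi Set.univ fun _ : Fin 2 =>
      Set.pi Set.univ fun _ : Fin 2 => Metric.closedBall (0 : ℂ) 1) :=
    isCompact_univ_pi fun _ => isCompact_univ_pi fun _ => isCompact_closedBall _ _
  refine IsCompact.of_isClosed_subset hK ?_ ?_
  · have h1 : IsClosed {A : Matrix (Fin 2) (Fin 2) ℂ | A * star A = 1} :=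
      isClosed_eq (continuous_id.mul continuous_star) continuous_const
    have h2 : IsClosed {A : Matrix (Fin 2) (Fin 2) ℂ | A.det = 1} :=
      isClosed_eq (Continuous.matrix_det continuous_id) continuous_const
    convert! h1.inter h2 using 1
    ext A
    simp only [SetLike.mem_coe, Matrix.mem_specialUnitaryGroup_iff, Matrix.mem_unitaryGroup_iff,
      Set.mem_inter_iff, Set.mem_ofPred_eq]
  · intro A hA i _ j _
    simpa using norm_entry_le ⟨A, hA⟩ i j

/-- The Haar measure on `SU(2)`, normalised to total volume `1`. -/
noncomputable def haar : Measure SU2 := Measure.haarMeasure ⊤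

instance : haar.IsHaarMeasure := by
  unfold haar
  infer_instance

instance : IsProbabilityMeasure haar :=
  ⟨by simpa [haar] using Measure.haarMeasure_self (K₀ := (⊤ : TopologicalSpace.PositiveCompacts SU2))⟩

/-- The linear substitution `X_i ↦ ∑ j, g_{ji} X_j`: the extension to the polynomial ring
`ℂ[X₀, X₁]` (the symmetric algebra of `ℂ²` with basis `X₀, X₁`) of the defining action of `SU(2)`
on `ℂ²`. -/
noncomputable def substitution (g : SU2) :
    MvPolynomial (Fin 2) ℂ →ₐ[ℂ] MvPolynomial (Fin 2) ℂ :=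
  MvPolynomial.aeval fun i => ∑ j, MvPolynomial.C (g.1 j i) * MvPolynomial.X j

theorem substitution_mem (g : SU2) (n : ℕ) (p : MvPolynomial (Fin 2) ℂ)
    (hp : p ∈ MvPolynomial.homogeneousSubmodule (Fin 2) ℂ n) :
    (substitution g).toLinearMap p ∈ MvPolynomial.homogeneousSubmodule (Fin 2) ℂ n := by
  rw [MvPolynomial.mem_homogeneousSubmodule] at hp ⊢
  have h := hp.aeval (fun i => ∑ j, MvPolynomial.C (g.1 j i) * MvPolynomial.X j) (n := 1)
    (fun i => MvPolynomial.IsHomogeneous.sum _ _ _ fun j _ => by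
      simpa using (MvPolynomial.isHomogeneous_C (Fin 2) (g.1 j i)).mul
        (MvPolynomial.isHomogeneous_X ℂ j))
  rw [one_mul] at h
  exact h

theorem substitution_one : substitution 1 = AlgHom.id ℂ _ := by
  apply MvPolynomial.algHom_ext
  intro i
  fin_cases i <;> simp [substitution, Matrix.one_apply]

theorem substitution_mul (g h : SU2) :
    substitution (g * h) = (substitution g).comp (substitution h) := by
  apply MvPolynomial.algHom_ext
  intro i
  simp only [substitution, AlgHom.comp_apply, MvPolynomial.aeval_X, map_mul,
    Submonoid.coe_mul, Matrix.mul_apply, MvPolynomial.aeval_C, Fin.sum_univ_two,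
    MvPolynomial.algebraMap_eq, map_add]
  ring

/-- The irreducible representation of `SU(2)` of spin `n`, of dimension `n + 1`: the `n`-th
symmetric power of the defining representation, realised on the homogeneous polynomials of degree
`n` in two variables. -/
noncomputable def rep (n : ℕ) :
    Representation ℂ SU2 (MvPolynomial.homogeneousSubmodule (Fin 2) ℂ n) where
  toFun g := (substitution g).toLinearMap.restrict (substitution_mem g n)
  map_one' := by
    ext p : 2
    simp [substitution_one]
  map_mul' g h := by
    ext p : 2
    simp [substitution_mul]

/-- The character of the irreducible representation of spin `n`. -/
noncomputable def chi (n : ℕ) (g : SU2) : ℂ := LinearMap.trace ℂ _ (rep n g)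

end SU2

/-- A graph as a one-dimensional cell complex with vertices `V` and edges `E`: the two ends `0`
and `1` of each edge are attached to vertices. Multiple edges and loops are allowed. The numbering
of the two ends of an edge is arbitrary. -/
structure CellGraph (V E : Type*) where
  /-- `ends e 0` and `ends e 1` are the vertices `e(0)` and `e(1)` of the edge `e`. -/
  ends : E → Fin 2 → V

namespace CellGraph

variable {V E W F : Type*}

/-- The invariant of a finite graph with edges labelled by spins: the integral, over one copy of
`SU(2)` for each vertex, of the product of the edge weights
`(-1)^{n_e} Tr ρ_e (h_{e(0)} h_{e(1)}⁻¹)`. -/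
noncomputable def invariant [Finite V] [Finite E] (Γ : CellGraph V E) (spin : E → ℕ) : ℂ :=
  letI := Fintype.ofFinite V
  letI := Fintype.ofFinite E
  ∫ h : V → SU2,
    ∏ e : E, (-1 : ℂ) ^ spin e * SU2.chi (spin e) (h (Γ.ends e 0) * (h (Γ.ends e 1))⁻¹)
    ∂(Measure.pi fun _ : V => SU2.haar)

/-- The equivalence relation on the vertices that identifies the two ends of the edge `e₀` and
nothing else. -/
def endsSetoid (Γ : CellGraph V E) (e₀ : E) : Setoid V where
  r x y := x = y ∨ (x ∈ Set.range (Γ.ends e₀) ∧ y ∈ Set.range (Γ.ends e₀))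
  iseqv :=
    { refl := fun _ => Or.inl rfl
      symm := by
        rintro x y (h | h)
        · exact Or.inl h.symm
        · exact Or.inr h.symm
      trans := by
        rintro x y z (rfl | h) (rfl | h')
        · exact Or.inl rfl
        · exact Or.inr h'
        · exact Or.inr h
        · exact Or.inr ⟨h.1, h'.2⟩ }

/-- The contraction of the edge `e₀`: the edge is removed and its two ends are identified. -/
def contract (Γ : CellGraph V E) (e₀ : E) :
    CellGraph (Quotient (Γ.endsSetoid e₀)) {e : E // e ≠ e₀} where
  ends e i := Quotient.mk _ (Γ.ends e i)

/-- A graph is a tree if it has neither loops nor multiple edges and its underlying simple graph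
is a tree (connected and without cycles). -/
def IsTree (T : CellGraph W F) : Prop :=
  (∀ f, T.ends f 0 ≠ T.ends f 1) ∧
  Function.Injective (fun f => s(T.ends f 0, T.ends f 1)) ∧
  (SimpleGraph.fromEdgeSet (Set.range fun f => s(T.ends f 0, T.ends f 1))).IsTree

open Classical in
/-- The expansion of the vertex `v` of `Γ` as a graph `T` (to be used for a tree `T`): the vertex
`v` is replaced by `T`, and each end `(e, i)` of an edge of `Γ` that was attached to `v` is now
attached to the vertex `attach e i` of `T`. (The values of `attach` at the other ends are not
used.) -/
noncomputable def expand (Γ : CellGraph V E) (v : V) (T : CellGraph W F)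
    (attach : E → Fin 2 → W) : CellGraph ({u : V // u ≠ v} ⊕ W) (E ⊕ F) where
  ends
    | Sum.inl e, i =>
        if h : Γ.ends e i = v then Sum.inr (attach e i) else Sum.inl ⟨Γ.ends e i, h⟩
    | Sum.inr f, i => Sum.inr (T.ends f i)

end CellGraph

/-!
All three parts say that `∑ (n + 1) χ_n` is the delta function at `1` on `SU(2)`.

For a continuous function this holds in the sense of Abel summation. Every element of `SU(2)` is
conjugate to a diagonal matrix, which gives the recursion `χ_{n+2} = Tr · χ_{n+1} - χ_n` and the
bound `|χ_n| ≤ n + 1`. The recursion sums the series `∑ (n + 1) rⁿ χ_n` to the positive kernel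
`(1 - r²) / (1 - r Tr + r²)²` (`SU2.hasSum_kernel`), which has total mass `1` and concentrates at `1`
as `r → 1`. So `∑ (n + 1) rⁿ ∫ F χ_n` tends to `F 1` (`SU2.tendsto_tsum_integral_mul_chi`), and
applying this to `F x = ∫ f (x h, h) dh` gives the character identity; Abel's limit theorem covers
the case of a convergent series.

For a function `F` that is a polynomial of degree at most `D` in the matrix entries, `∫ F χ_n = 0`
for `n > D` (`SU2.integral_mul_chi_eq_zero`). Indeed, comparison of the weights under right
translation by diagonal matrices shows that `F` is orthogonal to the matrix coefficients of the
highest weight vector `X₀ ^ n`; being orthogonal for all `F` is a translation invariant condition on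
the vector, and the translates of `X₀ ^ n` span the representation. Hence the expansion of the delta
function is finite on `F` (`SU2.sum_integral_mul_chi`).

The integrand of a graph invariant is polynomial, of a degree bounded by the spins, in any group
element that translates some set `S` of the variables (`SU2.IsPolyLE`). If a single edge leaves `S`
among a family of edges, then translating the variables in `S` does not change the weights of the
other edges of the family, because characters are class functions, and the variable of this edge can
be integrated out first (`SU2.integral_cut`). This shows that the invariant vanishes when the spin
of the edge is large; for a tree every edge is such an edge, being a bridge. With `S` a single
vertex, it shows that summation over the spin of an edge identifies the variables at its two ends,
which is the contraction formula. For a tree, the edges are integrated out in this way from the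
leaves to a root (`SU2.exists_integral_truncDelta_forest`).
-/

/-! ### Haar measure and matrix entries on `SU(2)` -/

namespace SU2

instance : SecondCountableTopology SU2 :=
  haveI : SecondCountableTopology (Matrix (Fin 2) (Fin 2) ℂ) :=
    inferInstanceAs (SecondCountableTopology (Fin 2 → Fin 2 → ℂ))
  TopologicalSpace.Subtype.secondCountableTopology _

/-- `SU(2)` is compact, hence unimodular. -/
instance : haar.IsMulRightInvariant where
  map_mul_right_eq_self g := by
    have h1 : MeasurePreserving (MulAut.conj g⁻¹).toMonoidHom haar haar :=
      MonoidHom.measurePreserving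
        (by
          change Continuous fun x : SU2 => g⁻¹ * x * g⁻¹⁻¹
          fun_prop)
        (MulAut.conj g⁻¹).surjective rfl
    have h2 := (measurePreserving_mul_left haar g).comp h1
    have h3 : (fun x => x * g) = (fun x => g * x) ∘ (MulAut.conj g⁻¹).toMonoidHom := by
      funext x
      simp [mul_assoc]
    rw [h3, h2.map_eq]

theorem integrable_of_continuous {X : Type*} [TopologicalSpace X] [CompactSpace X]
    [MeasurableSpace X] [OpensMeasurableSpace X] {μ : Measure X} [IsFiniteMeasure μ]
    {f : X → ℂ} (hf : Continuous f) : Integrable f μ :=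
  hf.integrable_of_hasCompactSupport (HasCompactSupport.of_compactSpace f)

theorem continuous_entry (i j : Fin 2) : Continuous fun g : SU2 => g.1 i j :=
  continuous_subtype_val.matrix_elem i j

theorem inv_val (g : SU2) : (g⁻¹).1 = star g.1 := rfl

theorem det_eq (g : SU2) : g.1 0 0 * g.1 1 1 - g.1 0 1 * g.1 1 0 = 1 := by
  rw [← Matrix.det_fin_two]; exact g.2.2

theorem inv_val_eq_adjugate (g : SU2) : (g⁻¹).1 = g.1.adjugate := by
  have h : g.1 * g.1.adjugate = 1 := by
    rw [Matrix.mul_adjugate, show g.1.det = 1 from g.2.2, one_smul]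
  have h2 : (g⁻¹).1 * g.1 = 1 := congrArg Subtype.val (inv_mul_cancel g)
  exact left_inv_eq_right_inv h2 h

theorem entry_11 (g : SU2) : g.1 1 1 = star (g.1 0 0) := by
  have := congrFun₂ (inv_val_eq_adjugate g) 0 0
  simpa [inv_val, Matrix.adjugate_fin_two] using this.symm

theorem entry_01 (g : SU2) : g.1 0 1 = - star (g.1 1 0) := by
  have := congrFun₂ (inv_val_eq_adjugate g) 0 1
  simp [inv_val, Matrix.adjugate_fin_two] at this
  simp [this]

theorem normSq_add (g : SU2) : ‖g.1 0 0‖ ^ 2 + ‖g.1 1 0‖ ^ 2 = 1 := by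
  have h := det_eq g
  rw [entry_11, entry_01] at h
  have : ((‖g.1 0 0‖ ^ 2 + ‖g.1 1 0‖ ^ 2 : ℝ) : ℂ) = 1 := by
    push_cast
    rw [← Complex.mul_conj', ← Complex.mul_conj']
    simp only [starRingEnd_apply]
    linear_combination h
  exact_mod_cast this

/-- The element of `SU(2)` with a given unit vector as its first column. -/
def ofColumn (a b : ℂ) (h : a * star a + b * star b = 1) : SU2 :=
  ⟨!![a, -star b; b, star a], by
    rw [Matrix.mem_specialUnitaryGroup_iff, Matrix.mem_unitaryGroup_iff]
    constructor
    · ext i j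
      simp only [Complex.star_def] at h
      fin_cases i <;> fin_cases j <;>
        simp [Matrix.mul_apply, Matrix.star_apply]
      · linear_combination h
      · ring
      · ring
      · linear_combination h
    · rw [Matrix.det_fin_two]
      simp at h ⊢
      linear_combination h⟩

end SU2

/-! ### The characters of `SU(2)` -/

namespace SU2
open MvPolynomial

/-- The exponent of the monomial `X₀ ^ j * X₁ ^ (n - j)`. -/
noncomputable def expo (n j : ℕ) : Fin 2 →₀ ℕ := Finsupp.single 0 j + Finsupp.single 1 (n - j)

theorem monomial_expo (n j : ℕ) :
    (monomial (expo n j) 1 : MvPolynomial (Fin 2) ℂ) = X 0 ^ j * X 1 ^ (n - j) := by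
  rw [X_pow_eq_monomial, X_pow_eq_monomial, monomial_mul, one_mul, expo]

theorem expo_injective (n : ℕ) : Function.Injective (expo n) := fun i j h => by
  simpa [expo] using DFunLike.congr_fun h 0

theorem expo_degree {n j : ℕ} (h : j ≤ n) : (expo n j).degree = n := by
  simp [expo, Finsupp.degree_eq_sum, h]

theorem eq_expo {n : ℕ} {d : Fin 2 →₀ ℕ} (h : d.degree = n) : d = expo n (d 0) := by
  simp [Finsupp.degree_eq_sum] at h
  ext i
  fin_cases i
  · simp [expo]
  · simp [expo]; omega

theorem eq_sum_monomial {n : ℕ} {p : MvPolynomial (Fin 2) ℂ} (hp : p.IsHomogeneous n) :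
    p = ∑ j : Fin (n + 1), monomial (expo n j) (coeff (expo n j) p) := by
  ext d
  rw [coeff_sum]
  by_cases hd : d.degree = n
  · obtain ⟨k, hk, rfl⟩ : ∃ k, k ≤ n ∧ d = expo n k :=
      ⟨d 0, by rw [← hd]; exact Finsupp.le_degree 0 d, eq_expo hd⟩
    rw [Finset.sum_eq_single ⟨k, by omega⟩]
    · simp
    · intro j _ hj
      rw [coeff_monomial, if_neg]
      intro h
      exact hj (Fin.ext (expo_injective n h))
    · simp
  · rw [hp.coeff_eq_zero hd]
    symm
    refine Finset.sum_eq_zero fun j _ => ?_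
    rw [coeff_monomial, if_neg]
    rintro rfl
    exact hd (expo_degree (by omega))

/-- The monomial basis of the space of homogeneous polynomials of degree `n`. -/
noncomputable def monomialBasis (n : ℕ) :
    Module.Basis (Fin (n + 1)) ℂ (homogeneousSubmodule (Fin 2) ℂ n) :=
  Module.Basis.ofEquivFun
    { toFun := fun p j => coeff (expo n j) p.1
      map_add' := fun p q => by ext j; simp
      map_smul' := fun c p => by ext j; simp
      invFun := fun c => ⟨∑ j : Fin (n + 1), monomial (expo n j) (c j),
        IsHomogeneous.sum _ _ _ fun j _ =>
          isHomogeneous_monomial _ (expo_degree (by omega))⟩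
      left_inv := fun p => Subtype.ext (eq_sum_monomial p.2).symm
      right_inv := fun c => by
        ext k
        simp only [coeff_sum]
        rw [Finset.sum_eq_single k]
        · simp
        · intro j _ hj
          rw [coeff_monomial, if_neg]
          intro h
          exact hj (Fin.ext (expo_injective n h))
        · simp }

/-- The trace in the monomial basis. -/
theorem chi_eq_sum_coeff (n : ℕ) (g : SU2) :
    chi n g = ∑ j : Fin (n + 1),
      coeff (expo n j) (substitution g (X 0 ^ (j : ℕ) * X 1 ^ (n - j))) := by
  rw [chi, LinearMap.trace_eq_matrix_trace ℂ (monomialBasis n), Matrix.trace]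
  refine Finset.sum_congr rfl fun j _ => ?_
  have h : ((monomialBasis n j : homogeneousSubmodule (Fin 2) ℂ n) : MvPolynomial (Fin 2) ℂ) =
      X 0 ^ (j : ℕ) * X 1 ^ (n - j) := by
    rw [← monomial_expo, monomialBasis, Module.Basis.coe_ofEquivFun]
    change ∑ i : Fin (n + 1), monomial (expo n i) ((Pi.single j 1 : Fin (n+1) → ℂ) i) = _
    rw [Finset.sum_eq_single j]
    · simp
    · intro i _ hi
      simp [hi]
    · simp
  rw [← h]
  rw [Matrix.diag, LinearMap.toMatrix_apply]
  rfl

theorem substitution_X (g : SU2) (i : Fin 2) :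
    substitution g (X i) = C (g.1 0 i) * X 0 + C (g.1 1 i) * X 1 := by
  simp [substitution, Fin.sum_univ_two]

theorem chi_conj (n : ℕ) (k g : SU2) : chi n (k * g * k⁻¹) = chi n g :=
  Representation.char_conj (rep n) g k

/-- Every element of `SU(2)` is conjugate to a diagonal one. -/
theorem exists_conj_diagonal (g : SU2) :
    ∃ k d : SU2, g = k * d * k⁻¹ ∧ d.1 1 0 = 0 ∧ d.1 0 1 = 0 := by
  obtain ⟨μ, hμ⟩ := Module.End.exists_eigenvalue (Matrix.toLin' g.1)
  obtain ⟨v, hv⟩ := hμ.exists_hasEigenvector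
  have hv1 : g.1.mulVec v = μ • v := by simpa using hv.apply_eq_smul
  have hv0 : v ≠ 0 := hv.2
  have hN : 0 < ‖v 0‖ ^ 2 + ‖v 1‖ ^ 2 := by
    by_contra hcon
    apply hv0
    have h0 : ‖v 0‖ ^ 2 = 0 := by nlinarith [sq_nonneg ‖v 0‖, sq_nonneg ‖v 1‖]
    have h1 : ‖v 1‖ ^ 2 = 0 := by nlinarith [sq_nonneg ‖v 0‖, sq_nonneg ‖v 1‖]
    ext i
    fin_cases i
    · simpa using h0
    · simpa using h1
  -- normalise the eigenvector and complete it to an element of `SU(2)`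
  set N : ℝ := Real.sqrt (‖v 0‖ ^ 2 + ‖v 1‖ ^ 2) with hNdef
  have hNpos : 0 < N := Real.sqrt_pos.mpr hN
  have hNsq : N ^ 2 = ‖v 0‖ ^ 2 + ‖v 1‖ ^ 2 := Real.sq_sqrt hN.le
  have hNsq' : (N : ℂ) ^ 2 = v 0 * star (v 0) + v 1 * star (v 1) := by
    simp only [Complex.star_def, Complex.mul_conj']
    exact_mod_cast hNsq
  have hNne : (N : ℂ) ≠ 0 := by exact_mod_cast hNpos.ne'
  have hk : v 0 / N * star (v 0 / N) + v 1 / N * star (v 1 / N) = 1 := by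
    simp only [star_div₀, Complex.star_def, Complex.conj_ofReal] at hNsq' ⊢
    field_simp
    linear_combination -hNsq'
  set k := ofColumn (v 0 / N) (v 1 / N) hk with hkdef
  have e0 := congrFun hv1 0
  have e1 := congrFun hv1 1
  simp [Matrix.mulVec, dotProduct, Fin.sum_univ_two] at e0 e1
  have h10 : (k⁻¹ * g * k).1 1 0 = 0 := by
    have hk' : (k⁻¹).1 = k.1.adjugate := inv_val_eq_adjugate k
    simp only [Submonoid.coe_mul, Matrix.mul_apply, Fin.sum_univ_two, hk',
      Matrix.adjugate_fin_two]
    simp [hkdef, ofColumn]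
    field_simp
    linear_combination v 0 * e1 - v 1 * e0
  refine ⟨k, k⁻¹ * g * k, by group, h10, ?_⟩
  rw [entry_01, h10]
  simp

theorem chi_diagonal (n : ℕ) {d : SU2} (h10 : d.1 1 0 = 0) (h01 : d.1 0 1 = 0) :
    chi n d = ∑ j ∈ Finset.range (n + 1), d.1 0 0 ^ j * d.1 1 1 ^ (n - j) := by
  rw [chi_eq_sum_coeff, Finset.sum_range]
  refine Finset.sum_congr rfl fun j _ => ?_
  rw [map_mul, map_pow, map_pow, substitution_X, substitution_X, h10, h01]
  simp only [map_zero, zero_mul, add_zero, zero_add, mul_pow]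
  have : C (d.1 0 0) ^ (j : ℕ) * X 0 ^ (j : ℕ) * (C (d.1 1 1) ^ (n - j) * X 1 ^ (n - j)) =
      C (d.1 0 0 ^ (j : ℕ) * d.1 1 1 ^ (n - j)) * monomial (expo n j) (1 : ℂ) := by
    rw [monomial_expo, map_mul, map_pow, map_pow]
    ring
  rw [this, coeff_C_mul, coeff_monomial, if_pos rfl, mul_one]

/-- The trace of an element of `SU(2)`, as a real number. -/
def tr (g : SU2) : ℝ := 2 * (g.1 0 0).re

theorem coe_tr (g : SU2) : (tr g : ℂ) = g.1 0 0 + g.1 1 1 := by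
  rw [entry_11, tr]
  simp [Complex.add_conj]

theorem tr_conj (k g : SU2) : tr (k * g * k⁻¹) = tr g := by
  have h (g : SU2) : (tr g : ℂ) = g.1.trace := by rw [coe_tr, Matrix.trace_fin_two]
  have : (tr (k * g * k⁻¹) : ℂ) = tr g := by
    rw [h, h]
    have : (k * g * k⁻¹).1 = k.1 * g.1 * (k⁻¹).1 := rfl
    rw [this, Matrix.trace_mul_comm, ← Matrix.mul_assoc]
    have : (k⁻¹).1 * k.1 = 1 := congrArg Subtype.val (inv_mul_cancel k)
    rw [this, one_mul]
  exact_mod_cast this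

theorem chi_zero (g : SU2) : chi 0 g = 1 := by
  rw [chi_eq_sum_coeff]
  simp [expo]

theorem chi_one (g : SU2) : chi 1 g = tr g := by
  rw [chi_eq_sum_coeff, coe_tr, Fin.sum_univ_two]
  simp [substitution_X, expo, coeff_C_mul, coeff_X, Finsupp.single_left_inj]
  ring

theorem chi_add_two (n : ℕ) (g : SU2) :
    chi (n + 2) g = tr g * chi (n + 1) g - chi n g := by
  obtain ⟨k, d, rfl, h10, h01⟩ := exists_conj_diagonal g
  rw [chi_conj, chi_conj, chi_conj, tr_conj, coe_tr, chi_diagonal _ h10 h01,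
    chi_diagonal _ h10 h01, chi_diagonal _ h10 h01]
  have hdet := det_eq d
  rw [h10, h01] at hdet
  set a := d.1 0 0
  set b := d.1 1 1
  -- the recursion follows from two instances of this one-step relation and `a * b = 1`
  have step (n : ℕ) : ∑ j ∈ Finset.range (n + 1 + 1), a ^ j * b ^ (n + 1 - j) =
      b * ∑ j ∈ Finset.range (n + 1), a ^ j * b ^ (n - j) + a ^ (n + 1) := by
    rw [Finset.sum_range_succ, Finset.mul_sum]
    congr 1
    · refine Finset.sum_congr rfl fun j hj => ?_
      have : n + 1 - j = (n - j) + 1 := by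
        have := Finset.mem_range.mp hj
        omega
      rw [this]
      ring
    · simp
  rw [step (n + 1), step n]
  linear_combination (- ∑ j ∈ Finset.range (n + 1), a ^ j * b ^ (n - j)) * hdet

theorem norm_chi_le (n : ℕ) (g : SU2) : ‖chi n g‖ ≤ n + 1 := by
  obtain ⟨k, d, rfl, h10, h01⟩ := exists_conj_diagonal g
  rw [chi_conj, chi_diagonal _ h10 h01]
  refine (norm_sum_le _ _).trans ?_
  have : ∀ j ∈ Finset.range (n + 1), ‖d.1 0 0 ^ j * d.1 1 1 ^ (n - j)‖ ≤ 1 := fun j _ => by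
    rw [norm_mul, norm_pow, norm_pow]
    exact mul_le_one₀ (pow_le_one₀ (norm_nonneg _) (norm_entry_le _ _ _)) (by positivity)
      (pow_le_one₀ (norm_nonneg _) (norm_entry_le _ _ _))
  simpa using Finset.sum_le_sum this

end SU2

/-! ### Polynomial functions on `SU(2)` -/

namespace SU2

/-- The span of the constant function `1` and the four matrix entries, as functions on `SU(2)`. -/
def affineFns : Submodule ℂ (SU2 → ℂ) :=
  Submodule.span ℂ (insert 1 (Set.range fun (ij : Fin 2 × Fin 2) (g : SU2) => g.1 ij.1 ij.2))

/-- The functions on `SU(2)` that are polynomials of degree at most `D` in the matrix entries. -/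
def polyLE (D : ℕ) : Submodule ℂ (SU2 → ℂ) := affineFns ^ D

theorem one_mem_affineFns : (1 : SU2 → ℂ) ∈ affineFns := Submodule.subset_span (Or.inl rfl)

theorem entry_mem_affineFns (i j : Fin 2) : (fun g : SU2 => g.1 i j) ∈ affineFns :=
  Submodule.subset_span (Or.inr ⟨(i, j), rfl⟩)

theorem polyLE_mono {D D' : ℕ} (h : D ≤ D') : polyLE D ≤ polyLE D' := by
  have : (1 : Submodule ℂ (SU2 → ℂ)) ≤ affineFns := by
    rw [Submodule.one_le]
    exact one_mem_affineFns
  exact pow_le_pow_right₀ this h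

theorem mul_mem_polyLE {D D' : ℕ} {f f' : SU2 → ℂ} (h : f ∈ polyLE D) (h' : f' ∈ polyLE D') :
    (fun g => f g * f' g) ∈ polyLE (D + D') := by
  rw [polyLE, pow_add]
  exact Submodule.mul_mem_mul h h'

theorem const_mem_polyLE (c : ℂ) (D : ℕ) : (fun _ : SU2 => c) ∈ polyLE D := by
  refine polyLE_mono (Nat.zero_le D) ?_
  rw [polyLE, pow_zero]
  exact Submodule.algebraMap_mem c

theorem prod_mem_polyLE {ι : Type*} (s : Finset ι) {D : ι → ℕ} {f : ι → SU2 → ℂ}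
    (h : ∀ i ∈ s, f i ∈ polyLE (D i)) :
    (fun g => ∏ i ∈ s, f i g) ∈ polyLE (∑ i ∈ s, D i) := by
  classical
  induction s using Finset.induction_on with
  | empty => simpa using const_mem_polyLE 1 0
  | insert i s hi ih =>
    simp only [Finset.prod_insert hi, Finset.sum_insert hi]
    exact mul_mem_polyLE (h i (Finset.mem_insert_self i s))
      (ih fun j hj => h j (Finset.mem_insert_of_mem hj))

theorem comp_mem_polyLE {φ : SU2 → SU2}
    (hφ : ∀ i j : Fin 2, (fun g : SU2 => (φ g).1 i j) ∈ affineFns)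
    {D : ℕ} {f : SU2 → ℂ} (hf : f ∈ polyLE D) : (fun g => f (φ g)) ∈ polyLE D := by
  have hE : ∀ e ∈ affineFns, (fun g => e (φ g)) ∈ affineFns := by
    intro e he
    induction he using Submodule.span_induction with
    | mem e he =>
      rcases he with rfl | ⟨ij, rfl⟩
      · exact one_mem_affineFns
      · exact hφ _ _
    | zero => exact zero_mem affineFns
    | add x y _ _ hx hy => exact add_mem hx hy
    | smul c x _ hx => exact affineFns.smul_mem c hx
  induction hf using Submodule.pow_induction_on_left' with
  | algebraMap r => exact const_mem_polyLE r 0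
  | add x y i _ _ hx hy => exact add_mem hx hy
  | mem_mul m hm i x _ hx =>
    rw [polyLE, pow_succ']
    exact Submodule.mul_mem_mul (hE m hm) hx

theorem mul_left_mem_polyLE {D : ℕ} {f : SU2 → ℂ} (hf : f ∈ polyLE D) (k : SU2) :
    (fun g => f (k * g)) ∈ polyLE D := by
  refine comp_mem_polyLE (φ := fun g => k * g) (fun i j => ?_) hf
  simp only [Submonoid.coe_mul, Matrix.mul_apply, Fin.sum_univ_two]
  exact add_mem (affineFns.smul_mem _ (entry_mem_affineFns _ _))
    (affineFns.smul_mem _ (entry_mem_affineFns _ _))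

theorem mul_right_mem_polyLE {D : ℕ} {f : SU2 → ℂ} (hf : f ∈ polyLE D) (k : SU2) :
    (fun g => f (g * k)) ∈ polyLE D := by
  refine comp_mem_polyLE (φ := fun g => g * k) (fun i j => ?_) hf
  simp only [Submonoid.coe_mul, Matrix.mul_apply, Fin.sum_univ_two, mul_comm _ (k.1 _ j)]
  exact add_mem (affineFns.smul_mem _ (entry_mem_affineFns _ _))
    (affineFns.smul_mem _ (entry_mem_affineFns _ _))

/-- The inverse of an element of `SU(2)` is its adjugate, so that its entries are again linear. -/
theorem inv_mem_polyLE {D : ℕ} {f : SU2 → ℂ} (hf : f ∈ polyLE D) :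
    (fun g => f g⁻¹) ∈ polyLE D := by
  refine comp_mem_polyLE (φ := fun g => g⁻¹) (fun i j => ?_) hf
  simp only [inv_val_eq_adjugate, Matrix.adjugate_fin_two]
  fin_cases i <;> fin_cases j
  · exact entry_mem_affineFns 1 1
  · exact neg_mem (entry_mem_affineFns 0 1)
  · exact neg_mem (entry_mem_affineFns 1 0)
  · exact entry_mem_affineFns 0 0

theorem chi_mem_polyLE (n : ℕ) : chi n ∈ polyLE n := by
  induction n using Nat.strong_induction_on with
  | _ n ih =>
    match n with
    | 0 =>
      rw [show chi 0 = fun _ => 1 from funext chi_zero]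
      exact const_mem_polyLE 1 0
    | 1 =>
      rw [show chi 1 = fun g => g.1 0 0 + g.1 1 1 from
        funext fun g => by rw [chi_one, coe_tr], polyLE, pow_one]
      exact add_mem (entry_mem_affineFns 0 0) (entry_mem_affineFns 1 1)
    | n + 2 =>
      rw [show chi (n + 2) = fun g => chi 1 g * chi (n + 1) g - chi n g from
        funext fun g => by rw [chi_add_two, chi_one]]
      refine sub_mem ?_ (polyLE_mono (by omega) (ih n (by omega)))
      rw [show n + 2 = 1 + (n + 1) by ring]
      exact mul_mem_polyLE (ih 1 (by omega)) (ih (n + 1) (by omega))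

theorem continuous_of_mem_polyLE {D : ℕ} {f : SU2 → ℂ} (hf : f ∈ polyLE D) : Continuous f := by
  have hE : ∀ e ∈ affineFns, Continuous e := by
    intro e he
    induction he using Submodule.span_induction with
    | mem e he =>
      rcases he with rfl | ⟨ij, rfl⟩
      · exact continuous_const
      · exact continuous_entry _ _
    | zero => exact continuous_const
    | add x y _ _ hx hy => exact hx.add hy
    | smul c x _ hx => exact hx.const_smul c
  induction hf using Submodule.pow_induction_on_left' with
  | algebraMap r => exact continuous_const
  | add x y i _ _ hx hy => exact hx.add hy
  | mem_mul m hm i x _ hx => exact (hE m hm).mul hx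

@[fun_prop]
theorem continuous_chi (n : ℕ) : Continuous (chi n) := continuous_of_mem_polyLE (chi_mem_polyLE n)

/-! ### Orthogonality of the characters to polynomials of small degree -/

/-- The monomial with exponents `a, c` in the first and `b, d` in the second column. -/
def entryMonomial (a b c d : ℕ) (g : SU2) : ℂ :=
  g.1 0 0 ^ a * g.1 0 1 ^ b * g.1 1 0 ^ c * g.1 1 1 ^ d

@[fun_prop]
theorem continuous_entryMonomial (a b c d : ℕ) : Continuous (entryMonomial a b c d) := by
  unfold entryMonomial
  exact ((((continuous_entry 0 0).pow a).mul ((continuous_entry 0 1).pow b)).mul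
    ((continuous_entry 1 0).pow c)).mul ((continuous_entry 1 1).pow d)

/-- Right translation by a diagonal matrix multiplies the monomial by a scalar, which can be made
`-1`. -/
theorem integral_entryMonomial_eq_zero {a b c d : ℕ} (h : b + d < a + c) :
    ∫ g, entryMonomial a b c d g ∂haar = 0 := by
  obtain ⟨m, hm⟩ := Nat.exists_eq_add_of_lt h
  -- chosen so that the diagonal matrix with entries `z` and `z⁻¹` acts by `z ^ (m + 1) = -1`
  set z : ℂ := Complex.exp (Real.pi * Complex.I / (m + 1 : ℕ)) with hz
  have hzm : z ^ (m + 1) = -1 := by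
    rw [hz, ← Complex.exp_nat_mul, mul_div_cancel₀ _ (by exact_mod_cast Nat.succ_ne_zero m),
      Complex.exp_pi_mul_I]
  have hzz : z * star z = 1 := by
    rw [Complex.star_def, Complex.mul_conj', hz,
      show (Real.pi * Complex.I / (m + 1 : ℕ) : ℂ) =
        ((Real.pi / (m + 1 : ℕ) : ℝ) : ℂ) * Complex.I by push_cast; ring,
      Complex.norm_exp_ofReal_mul_I]
    simp
  set k := ofColumn z 0 (by simpa using hzz) with hk
  have key : ∀ g, entryMonomial a b c d (g * k) = - entryMonomial a b c d g := by
    intro g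
    have : z ^ (a + c) * star z ^ (b + d) = -1 := by
      rw [hm, show b + d + m + 1 = (m + 1) + (b + d) by ring, pow_add, mul_assoc, ← mul_pow, hzz,
        hzm]
      simp
    simp only [entryMonomial, Submonoid.coe_mul, Matrix.mul_apply, Fin.sum_univ_two, hk, ofColumn]
    simp at this ⊢
    simp only [mul_pow]
    rw [pow_add, pow_add] at this
    linear_combination (g.1 0 0 ^ a * g.1 0 1 ^ b * g.1 1 0 ^ c * g.1 1 1 ^ d) * this
  have h1 := integral_mul_right_eq_self (μ := haar) (entryMonomial a b c d) k
  simp only [key, integral_neg] at h1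
  linear_combination (-1 / 2) * h1

/-- Each factor of degree one changes the weight by at most one. -/
theorem integral_mul_entryMonomial_eq_zero {D : ℕ} {f : SU2 → ℂ} (hf : f ∈ polyLE D)
    {a b c d : ℕ} (h : b + d + D < a + c) : ∫ g, f g * entryMonomial a b c d g ∂haar = 0 := by
  induction hf using Submodule.pow_induction_on_left' generalizing a b c d with
  | algebraMap r =>
    change ∫ g, r * entryMonomial a b c d g ∂haar = 0
    rw [integral_const_mul, integral_entryMonomial_eq_zero (by omega), mul_zero]
  | add x y i hx' hy' hx hy =>
    have hxc := continuous_of_mem_polyLE (D := i) hx'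
    have hyc := continuous_of_mem_polyLE (D := i) hy'
    simp only [Pi.add_apply, add_mul]
    rw [integral_add (integrable_of_continuous (by fun_prop))
      (integrable_of_continuous (by fun_prop)), hx h, hy h, add_zero]
  | mem_mul m hm i x hx' hx =>
    have hxc := continuous_of_mem_polyLE (D := i) hx'
    suffices hs : Continuous m ∧ ∫ g, (m * x) g * entryMonomial a b c d g ∂haar = 0 from hs.2
    induction hm using Submodule.span_induction with
    | mem e he =>
      rcases he with rfl | ⟨⟨p, q⟩, rfl⟩
      · exact ⟨continuous_const, by simpa using hx (by omega)⟩
      · refine ⟨continuous_entry _ _, ?_⟩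
        fin_cases p <;> fin_cases q
        · rw [← hx (a := a + 1) (b := b) (c := c) (d := d) (by omega)]
          congr 1; ext g; simp [entryMonomial]; ring
        · rw [← hx (a := a) (b := b + 1) (c := c) (d := d) (by omega)]
          congr 1; ext g; simp [entryMonomial]; ring
        · rw [← hx (a := a) (b := b) (c := c + 1) (d := d) (by omega)]
          congr 1; ext g; simp [entryMonomial]; ring
        · rw [← hx (a := a) (b := b) (c := c) (d := d + 1) (by omega)]
          congr 1; ext g; simp [entryMonomial]; ring
    | zero => exact ⟨continuous_const, by simp⟩
    | add y z _ _ hy hz =>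
      have hyc := hy.1
      have hzc := hz.1
      refine ⟨hy.1.add hz.1, ?_⟩
      simp only [add_mul, Pi.add_apply]
      rw [integral_add (integrable_of_continuous (by fun_prop))
        (integrable_of_continuous (by fun_prop)), hy.2, hz.2, add_zero]
    | smul r y _ hy =>
      refine ⟨hy.1.const_smul r, ?_⟩
      simp only [smul_mul_assoc, Pi.smul_apply]
      rw [integral_smul, hy.2, smul_zero]

open MvPolynomial in
theorem continuous_coeff_substitution (p : MvPolynomial (Fin 2) ℂ) (d : Fin 2 →₀ ℕ) :
    Continuous fun g : SU2 => coeff d (substitution g p) := by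
  induction p using MvPolynomial.induction_on generalizing d with
  | C a => simp only [substitution, aeval_C]; exact continuous_const
  | add p q hp hq => simpa only [map_add, coeff_add] using (hp d).fun_add (hq d)
  | mul_X p i hp =>
    have h (j : Fin 2) : Continuous fun g : SU2 => coeff d (substitution g p * X j) := by
      simp only [coeff_mul_X']
      split_ifs
      · exact hp _
      · exact continuous_const
    have e : (fun g : SU2 => coeff d (substitution g (p * X i))) = fun g : SU2 =>
        g.1 0 i * coeff d (substitution g p * X 0) + g.1 1 i * coeff d (substitution g p * X 1) := by
      ext g
      rw [map_mul, substitution_X, mul_add, coeff_add, mul_left_comm, coeff_C_mul, mul_left_comm,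
        coeff_C_mul]
    rw [e]
    exact ((continuous_entry 0 i).mul (h 0)).add ((continuous_entry 1 i).mul (h 1))

open MvPolynomial in
theorem substitution_C_mul (g : SU2) (c : ℂ) (p : MvPolynomial (Fin 2) ℂ) :
    substitution g (C c * p) = C c * substitution g p := by
  rw [map_mul]
  congr 1
  exact aeval_C _ _

open MvPolynomial in
/-- The image of the highest weight vector. -/
theorem substitution_X_pow (g : SU2) (n : ℕ) :
    substitution g (X 0 ^ n) = ∑ m ∈ Finset.range (n + 1),
      C (g.1 0 0 ^ m * g.1 1 0 ^ (n - m) * n.choose m) * (X 0 ^ m * X 1 ^ (n - m)) := by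
  rw [map_pow, substitution_X, add_pow]
  refine Finset.sum_congr rfl fun m _ => ?_
  simp only [map_mul, map_pow, mul_pow, map_natCast]
  ring

open MvPolynomial in
theorem integral_mul_coeff_highest_eq_zero {D n : ℕ} (hD : D < n) {f : SU2 → ℂ}
    (hf : f ∈ polyLE D) {j : ℕ} (hj : j ≤ n) :
    ∫ g, f g * coeff (expo n j) (substitution g (X 0 ^ n)) ∂haar = 0 := by
  have h (g : SU2) : coeff (expo n j) (substitution g (X 0 ^ n)) =
      n.choose j * entryMonomial j 0 (n - j) 0 g := by
    rw [substitution_X_pow, coeff_sum, Finset.sum_eq_single j]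
    · rw [coeff_C_mul, ← monomial_expo, coeff_monomial, if_pos rfl]
      simp only [entryMonomial]
      ring
    · intro m _ hm
      rw [coeff_C_mul, ← monomial_expo, coeff_monomial,
        if_neg fun h => hm (expo_injective n h), mul_zero]
    · intro h
      exact absurd (Finset.mem_range.mpr (by omega)) h
  simp only [h, mul_left_comm (f _)]
  rw [integral_const_mul, integral_mul_entryMonomial_eq_zero hf (by omega), mul_zero]

open MvPolynomial in
/-- The vectors `v` whose matrix coefficients are all orthogonal to `polyLE D` form an invariant
subspace. If `D < n`, it contains the highest weight vector `X₀ ^ n`, hence all the powers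
`(a X₀ + b X₁) ^ n`; letting the phase of `a` vary, it contains every monomial. -/
theorem integral_mul_coeff_eq_zero {D n : ℕ} (hD : D < n) {f : SU2 → ℂ}
    (hf : f ∈ polyLE D) {j m : ℕ} (hj : j ≤ n) (hm : m ≤ n) :
    ∫ g, f g * coeff (expo n j) (substitution g (X 0 ^ m * X 1 ^ (n - m))) ∂haar = 0 := by
  have hfc := continuous_of_mem_polyLE hf
  set I : ℕ → ℂ := fun m =>
    ∫ g, f g * coeff (expo n j) (substitution g (X 0 ^ m * X 1 ^ (n - m))) ∂haar with hI
  set Q : Polynomial ℂ := ∑ m ∈ Finset.range (n + 1),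
    Polynomial.monomial m ((3 / 5 : ℂ) ^ m * (4 / 5) ^ (n - m) * n.choose m * I m) with hQ
  -- the powers used are `(3/5 z X₀ + 4/5 X₁) ^ n` with `|z| = 1`
  have hroot : ∀ z : ℂ, ‖z‖ = 1 → Q.IsRoot z := by
    intro z hz
    have hzz : z * star z = 1 := by simp [Complex.mul_conj', hz]
    set k := ofColumn (3 / 5 * z) (4 / 5) (by
      simp only [star_mul', star_div₀, Complex.star_def, map_ofNat] at hzz ⊢
      linear_combination (9 / 25) * hzz) with hk
    have h1 := integral_mul_coeff_highest_eq_zero hD (mul_right_mem_polyLE hf k⁻¹) hj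
    rw [← integral_mul_right_eq_self _ k] at h1
    simp only [mul_inv_cancel_right, substitution_mul, AlgHom.comp_apply] at h1
    simp only [substitution_X_pow k, map_sum, substitution_C_mul, coeff_sum, coeff_C_mul,
      Finset.mul_sum] at h1
    rw [integral_finsetSum] at h1
    · rw [Polynomial.IsRoot, hQ, Polynomial.eval_finsetSum, ← h1]
      refine Finset.sum_congr rfl fun m _ => ?_
      rw [Polynomial.eval_monomial, hI]
      simp only
      rw [mul_assoc, mul_comm (integral _ _), ← mul_assoc, ← integral_const_mul]
      congr 1
      ext g
      simp [hk, ofColumn, mul_pow]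
      ring
    · intro m _
      apply integrable_of_continuous
      exact hfc.mul (continuous_const.mul (continuous_coeff_substitution _ _))
  have hQ0 : Q = 0 := by
    apply Polynomial.eq_zero_of_infinite_isRoot
    have hinf : (Metric.sphere (0 : ℂ) 1).Infinite :=
      (isPreconnected_sphere (by simp) 0 1).infinite_of_nontrivial
        ⟨1, by simp, -1, by simp, by norm_num⟩
    exact hinf.mono fun z hz => hroot z (by simpa using hz)
  have hc : Q.coeff m = (3 / 5 : ℂ) ^ m * (4 / 5) ^ (n - m) * n.choose m * I m := by
    simp only [hQ, Polynomial.finsetSum_coeff, Polynomial.coeff_monomial]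
    rw [Finset.sum_ite_eq' (Finset.range (n + 1)) m, if_pos (Finset.mem_range.mpr (by omega))]
  rw [hQ0, Polynomial.coeff_zero] at hc
  have hne : (3 / 5 : ℂ) ^ m * (4 / 5) ^ (n - m) * n.choose m ≠ 0 := by
    have : (n.choose m : ℂ) ≠ 0 := by exact_mod_cast (Nat.choose_pos hm).ne'
    exact mul_ne_zero (mul_ne_zero (pow_ne_zero _ (by norm_num)) (pow_ne_zero _ (by norm_num))) this
  exact (mul_eq_zero.mp hc.symm).resolve_left hne

theorem integral_mul_chi_eq_zero {D n : ℕ} (hD : D < n) {f : SU2 → ℂ} (hf : f ∈ polyLE D) :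
    ∫ g, f g * chi n g ∂haar = 0 := by
  have hfc := continuous_of_mem_polyLE hf
  simp only [chi_eq_sum_coeff, Finset.mul_sum]
  rw [integral_finsetSum]
  · exact Finset.sum_eq_zero fun j _ => integral_mul_coeff_eq_zero hD hf (by omega) (by omega)
  · exact fun j _ => integrable_of_continuous (hfc.mul (continuous_coeff_substitution _ _))

end SU2

/-! ### Abel summation of the character expansion -/

namespace SU2

open Filter Topology

@[fun_prop]
theorem continuous_tr : Continuous tr :=
  continuous_const.mul (Complex.continuous_re.comp (continuous_entry 0 0))

theorem re_entry_le (g : SU2) : (g.1 0 0).re ≤ 1 :=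
  (Complex.re_le_norm _).trans (norm_entry_le g 0 0)

theorem tr_le (g : SU2) : tr g ≤ 2 := by
  have := re_entry_le g
  rw [tr]
  linarith

theorem eq_one_of_tr_eq {g : SU2} (h : tr g = 2) : g = 1 := by
  have hre : (g.1 0 0).re = 1 := by rw [tr] at h; linarith
  have hn := normSq_add g
  have h1 : 1 ≤ ‖g.1 0 0‖ := hre ▸ Complex.re_le_norm _
  have h10 : g.1 1 0 = 0 := by
    have : ‖g.1 1 0‖ ^ 2 ≤ 0 := by nlinarith
    simpa using le_antisymm this (sq_nonneg _)
  have him : (g.1 0 0).im = 0 := by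
    have h2 : ‖g.1 0 0‖ ^ 2 = 1 := by simpa [h10] using hn
    rw [Complex.sq_norm, Complex.normSq_apply, hre] at h2
    nlinarith
  have h00 : g.1 0 0 = 1 := Complex.ext hre him
  ext i j
  fin_cases i <;> fin_cases j
  · simpa using h00
  · simp [entry_01, h10]
  · simpa using h10
  · simp [entry_11, h00]

/-- The Poisson-type kernel `∑ (n + 1) rⁿ χ_n`, in closed form. -/
noncomputable def kernel (r : ℝ) (g : SU2) : ℝ := (1 - r ^ 2) / (1 - r * tr g + r ^ 2) ^ 2

theorem denom_pos {r : ℝ} (h0 : 0 < r) (h1 : r < 1) (g : SU2) : 0 < 1 - r * tr g + r ^ 2 := by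
  nlinarith [tr_le g, mul_nonneg h0.le (sub_nonneg.mpr (tr_le g)), sq_pos_of_pos (sub_pos.mpr h1)]

theorem summable_sq_mul_pow {r : ℝ} (h0 : 0 < r) (h1 : r < 1) :
    Summable fun n : ℕ => ((n : ℝ) + 1) * (n + 1) * r ^ n := by
  have hr : ‖r‖ < 1 := by rwa [Real.norm_of_nonneg h0.le]
  have h := ((summable_pow_mul_geometric_of_norm_lt_one 2 hr).add
    ((summable_pow_mul_geometric_of_norm_lt_one 1 hr).mul_left 2)).add
    (summable_pow_mul_geometric_of_norm_lt_one 0 hr)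
  refine h.congr fun n => ?_
  ring

theorem hasSum_kernel {r : ℝ} (h0 : 0 < r) (h1 : r < 1) (g : SU2) :
    HasSum (fun n : ℕ => ((n : ℂ) + 1) * (r : ℂ) ^ n * chi n g) (kernel r g) := by
  set u : ℕ → ℂ := fun n => (r : ℂ) ^ n * chi n g with hu
  set v : ℕ → ℂ := fun n => ((n : ℂ) + 1) * (r : ℂ) ^ n * chi n g with hv
  have hsq := summable_sq_mul_pow h0 h1
  have nv : ∀ n : ℕ, ‖v n‖ ≤ ((n : ℝ) + 1) * (n + 1) * r ^ n := by
    intro n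
    have hn : ‖(n : ℂ) + 1‖ = n + 1 := by
      rw [← Nat.cast_succ, Complex.norm_natCast]; simp
    simp only [hv, norm_mul, norm_pow, Complex.norm_real, Real.norm_of_nonneg h0.le, hn]
    calc ((n : ℝ) + 1) * r ^ n * ‖chi n g‖ ≤ ((n : ℝ) + 1) * r ^ n * (n + 1) := by
          gcongr
          exact norm_chi_le n g
      _ = _ := by ring
  have sv : Summable v := Summable.of_norm_bounded hsq nv
  have su : Summable u := by
    refine Summable.of_norm_bounded hsq fun n => ?_
    have : ‖u n‖ ≤ ‖v n‖ := by
      have hn : ‖(n : ℂ) + 1‖ = n + 1 := by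
        rw [← Nat.cast_succ, Complex.norm_natCast]; simp
      simp only [hv, hu, mul_assoc]
      rw [norm_mul ((n : ℂ) + 1), hn]
      exact le_mul_of_one_le_left (norm_nonneg _) (by simp)
    exact this.trans (nv n)
  have su1 : Summable fun n => u (n + 1) := (summable_nat_add_iff 1).mpr su
  have sv1 : Summable fun n => v (n + 1) := (summable_nat_add_iff 1).mpr sv
  have e1 : ∑' n, u n = 1 + ∑' n, u (n + 1) := by
    rw [su.tsum_eq_zero_add]; simp [hu, chi_zero]
  have e2 : ∑' n, v n = 1 + ∑' n, v (n + 1) := by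
    rw [sv.tsum_eq_zero_add]; simp [hv, chi_zero]
  have e3 : ∑' n, u (n + 1) = r * tr g + ∑' n, u (n + 2) := by
    rw [su1.tsum_eq_zero_add]; simp [hu, chi_one]
  have e4 : ∑' n, v (n + 1) = 2 * r * tr g + ∑' n, v (n + 2) := by
    rw [sv1.tsum_eq_zero_add]
    congr 1
    simp only [hv, zero_add, pow_one, Nat.cast_one, chi_one]
    ring
  -- the recursion of the characters gives linear equations for the two sums
  have e5 : ∑' n, u (n + 2) = r * tr g * ∑' n, u (n + 1) - r ^ 2 * ∑' n, u n := by
    rw [← tsum_mul_left, ← tsum_mul_left, ← (su1.mul_left _).tsum_sub (su.mul_left _)]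
    refine tsum_congr fun n => ?_
    simp only [hu, chi_add_two]
    ring
  have e6 : ∑' n, v (n + 2) = r * tr g * (∑' n, v (n + 1) + ∑' n, u (n + 1)) -
      r ^ 2 * (∑' n, v n + 2 * ∑' n, u n) := by
    rw [← sv1.tsum_add su1, ← tsum_mul_left (a := (2 : ℂ)), ← sv.tsum_add (su.mul_left 2),
      ← tsum_mul_left, ← tsum_mul_left,
      ← ((sv1.add su1).mul_left _).tsum_sub ((sv.add (su.mul_left 2)).mul_left _)]
    refine tsum_congr fun n => ?_
    simp only [hu, hv, chi_add_two]
    push_cast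
    ring
  have hq : (1 - r * tr g + r ^ 2 : ℂ) ≠ 0 := by
    exact_mod_cast (denom_pos h0 h1 g).ne'
  have hA : ∑' n, v n = kernel r g := by
    rw [kernel]
    push_cast
    rw [eq_div_iff (pow_ne_zero 2 hq)]
    set S := ∑' n, u n
    set A := ∑' n, v n
    have hS : S * (1 - r * tr g + r ^ 2) = 1 := by
      linear_combination e1 + e3 + e5 - (r * tr g : ℂ) * e1
    have hA : A * (1 - r * tr g + r ^ 2) = 1 + (r * tr g - 2 * r ^ 2) * S := by
      linear_combination e2 + e4 + e6 - (r * tr g : ℂ) * (e1 + e2)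
    linear_combination (1 - r * tr g + r ^ 2 : ℂ) * hA + (r * tr g - 2 * r ^ 2 : ℂ) * hS
  rw [← hA]
  exact sv.hasSum

/-- Summation and integration can be interchanged for `r < 1`. -/
theorem hasSum_integral_kernel {r : ℝ} (h0 : 0 < r) (h1 : r < 1) {F : SU2 → ℂ}
    (hF : Continuous F) :
    HasSum (fun n : ℕ => ((n : ℂ) + 1) * (∫ g, F g * chi n g ∂haar) * (r : ℂ) ^ n)
      (∫ g, kernel r g • F g ∂haar) := by
  obtain ⟨M, hM⟩ := isCompact_univ.exists_bound_of_continuousOn hF.continuousOn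
  have h := hasSum_integral_of_summable_integral_norm (μ := haar)
    (F := fun (n : ℕ) g => F g * (((n : ℂ) + 1) * (r : ℂ) ^ n * chi n g))
    (fun n => integrable_of_continuous (by fun_prop)) ?_
  · have e (g : SU2) : ∑' n : ℕ, F g * (((n : ℂ) + 1) * (r : ℂ) ^ n * chi n g) =
        kernel r g • F g := by
      rw [tsum_mul_left, (hasSum_kernel h0 h1 g).tsum_eq, Complex.real_smul, mul_comm]
    simp only [e] at h
    refine h.congr_fun fun n => ?_
    rw [mul_assoc, mul_comm (integral _ _), ← mul_assoc, ← integral_const_mul]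
    congr 1
    ext g
    ring
  · refine Summable.of_nonneg_of_le (fun n => by positivity) (fun n => ?_)
      ((summable_sq_mul_pow h0 h1).mul_left M)
    refine (integral_mono_of_nonneg (Eventually.of_forall fun g => norm_nonneg _)
      (integrable_const (M * (((n : ℝ) + 1) * (n + 1) * r ^ n)))
      (Eventually.of_forall fun g => ?_)).trans ?_
    · have hn : ‖(n : ℂ) + 1‖ = n + 1 := by
        rw [← Nat.cast_succ, Complex.norm_natCast]; simp
      have hMg := hM g (Set.mem_univ g)
      have hM0 := (norm_nonneg _).trans hMg
      simp only [norm_mul, norm_pow, Complex.norm_real, Real.norm_of_nonneg h0.le, hn]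
      calc ‖F g‖ * (((n : ℝ) + 1) * r ^ n * ‖chi n g‖)
          ≤ M * (((n : ℝ) + 1) * r ^ n * (n + 1)) := by
            gcongr
            exact norm_chi_le n g
        _ = _ := by ring
    · simp

theorem integral_chi_eq_zero {n : ℕ} (hn : 0 < n) : ∫ g, chi n g ∂haar = 0 := by
  simpa using integral_mul_chi_eq_zero hn (const_mem_polyLE 1 0)

theorem integral_kernel {r : ℝ} (h0 : 0 < r) (h1 : r < 1) : ∫ g, kernel r g ∂haar = 1 := by
  have h := hasSum_integral_kernel h0 h1 (F := fun _ => 1) continuous_const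
  have h' := hasSum_single (f := fun n : ℕ =>
    ((n : ℂ) + 1) * (∫ g, 1 * chi n g ∂haar) * (r : ℂ) ^ n) 0 fun n hn => by
      simp only [one_mul, integral_chi_eq_zero (Nat.pos_of_ne_zero hn)]
      ring
  have e := h.unique h'
  simp only [chi_zero, Complex.real_smul, mul_one] at e
  rw [integral_complex_ofReal] at e
  simpa using e

theorem continuous_kernel {r : ℝ} (h0 : 0 < r) (h1 : r < 1) : Continuous (kernel r) := by
  unfold kernel
  exact continuous_const.div (by fun_prop) fun g => pow_ne_zero 2 (denom_pos h0 h1 g).ne'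

/-- The lower bound `1/2` is any positive number: it keeps `r` away from `0`. -/
theorem eventually_mem_Ioo : ∀ᶠ r : ℝ in 𝓝[<] 1, 2⁻¹ < r ∧ r < 1 :=
  Ioo_mem_nhdsLT (by norm_num)

theorem tendstoUniformlyOn_kernel {u : Set SU2} (hu : IsOpen u) (h1u : (1 : SU2) ∈ u) :
    TendstoUniformlyOn kernel 0 (𝓝[<] 1) uᶜ := by
  -- the trace stays away from `2` on the compact complement of `u`
  obtain ⟨δ, hδ, hδu⟩ : ∃ δ > 0, ∀ g ∈ uᶜ, δ ≤ 2 - tr g := by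
    rcases uᶜ.eq_empty_or_nonempty with he | hne
    · exact ⟨1, one_pos, by simp [he]⟩
    · obtain ⟨g₀, hg₀, hmin⟩ := hu.isClosed_compl.isCompact.exists_isMinOn hne
        (f := fun g => 2 - tr g) (by fun_prop)
      refine ⟨2 - tr g₀, ?_, fun g hg => hmin hg⟩
      refine sub_pos.mpr (lt_of_le_of_ne (tr_le g₀) fun h => hg₀ ?_)
      rw [eq_one_of_tr_eq h]
      exact h1u
  rw [Metric.tendstoUniformlyOn_iff]
  intro ε hε
  have hlim : Tendsto (fun r : ℝ => (1 - r ^ 2) / (2⁻¹ * δ) ^ 2) (𝓝[<] 1) (𝓝 0) := by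
    have : Continuous fun r : ℝ => (1 - r ^ 2) / (2⁻¹ * δ) ^ 2 := by fun_prop
    simpa using (this.tendsto 1).mono_left nhdsWithin_le_nhds
  filter_upwards [eventually_mem_Ioo, hlim.eventually (gt_mem_nhds hε)] with r ⟨hr0, hr1⟩ hr g hg
  have hr0' : 0 < r := by linarith
  have hnum : 0 ≤ 1 - r ^ 2 := by nlinarith
  have hq : 2⁻¹ * δ ≤ 1 - r * tr g + r ^ 2 := by
    have := hδu g hg
    nlinarith [sq_nonneg (1 - r), mul_le_mul hr0.le this hδ.le hr0'.le]
  have hk : kernel r g ≤ (1 - r ^ 2) / (2⁻¹ * δ) ^ 2 := by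
    unfold kernel
    gcongr
  have hk0 : 0 ≤ kernel r g := by unfold kernel; positivity
  rw [Pi.zero_apply, dist_zero_left, Real.norm_of_nonneg hk0]
  exact hk.trans_lt hr

/-- The character expansion of the delta function at `1`, in the sense of Abel summation. -/
theorem tendsto_tsum_integral_mul_chi {F : SU2 → ℂ} (hF : Continuous F) :
    Tendsto (fun r : ℝ => ∑' n : ℕ, ((n : ℂ) + 1) * (∫ g, F g * chi n g ∂haar) * (r : ℂ) ^ n)
      (𝓝[<] 1) (𝓝 (F 1)) := by
  have h := tendsto_integral_peak_smul_of_integrable_of_tendsto (μ := haar) (g := F)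
    (l := 𝓝[<] (1 : ℝ)) (x₀ := (1 : SU2)) (φ := kernel) (a := F 1) (t := Set.univ)
    MeasurableSet.univ univ_mem (measure_ne_top _ _) ?_ (fun u hu h1u =>
      tendstoUniformlyOn_kernel hu h1u) ?_ ?_ (integrable_of_continuous hF) hF.continuousAt
  · refine h.congr' ?_
    filter_upwards [eventually_mem_Ioo] with r ⟨hr0, hr1⟩
    exact (hasSum_integral_kernel (by linarith) hr1 hF).tsum_eq.symm
  · filter_upwards [eventually_mem_Ioo] with r ⟨hr0, hr1⟩ g
    have : 0 ≤ 1 - r ^ 2 := by nlinarith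
    unfold kernel
    positivity
  · refine tendsto_const_nhds.congr' ?_
    filter_upwards [eventually_mem_Ioo] with r ⟨hr0, hr1⟩
    rw [setIntegral_univ, integral_kernel (by linarith) hr1]
  · filter_upwards [eventually_mem_Ioo] with r ⟨hr0, hr1⟩
    exact (continuous_kernel (by linarith) hr1).aestronglyMeasurable

/-- For a polynomial function the expansion is finite. -/
theorem sum_integral_mul_chi {D N : ℕ} (hN : D < N) {F : SU2 → ℂ} (hF : F ∈ polyLE D) :
    ∑ n ∈ Finset.range N, ((n : ℂ) + 1) * ∫ g, F g * chi n g ∂haar = F 1 := by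
  have h := tendsto_tsum_integral_mul_chi (continuous_of_mem_polyLE hF)
  have e (r : ℝ) : ∑' n : ℕ, ((n : ℂ) + 1) * (∫ g, F g * chi n g ∂haar) * (r : ℂ) ^ n =
      ∑ n ∈ Finset.range N, ((n : ℂ) + 1) * (∫ g, F g * chi n g ∂haar) * (r : ℂ) ^ n := by
    refine tsum_eq_sum fun n hn => ?_
    rw [integral_mul_chi_eq_zero (by simp at hn; omega) hF]
    ring
  simp only [e] at h
  refine tendsto_nhds_unique ?_ h
  have hc : Continuous fun r : ℝ =>
      ∑ n ∈ Finset.range N, ((n : ℂ) + 1) * (∫ g, F g * chi n g ∂haar) * (r : ℂ) ^ n := by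
    fun_prop
  simpa using (hc.tendsto 1).mono_left nhdsWithin_le_nhds

theorem continuous_integral {X Y : Type*} [TopologicalSpace X] [FirstCountableTopology X]
    [LocallyCompactSpace X] [TopologicalSpace Y] [CompactSpace Y] [SecondCountableTopology Y]
    [MeasurableSpace Y] [OpensMeasurableSpace Y] {μ : Measure Y} [IsFiniteMeasure μ]
    {f : X → Y → ℂ} (hf : Continuous f.uncurry) : Continuous fun x => ∫ y, f x y ∂μ := by
  simpa using continuous_parametric_integral_of_continuous (μ := μ) hf isCompact_univ

/-- The substitution `g = x h` reduces the integral over two variables to one over `x`. -/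
theorem integral_prod_mul_chi {f : SU2 × SU2 → ℂ} (hf : Continuous f) (n : ℕ) :
    ∫ p, f p * chi n (p.1 * p.2⁻¹) ∂(haar.prod haar) =
      ∫ x, (∫ h, f (x * h, h) ∂haar) * chi n x ∂haar := by
  rw [integral_prod_symm _ (integrable_of_continuous (by fun_prop))]
  have e (h : SU2) : ∫ g, f (g, h) * chi n (g * h⁻¹) ∂haar =
      ∫ x, f (x * h, h) * chi n x ∂haar := by
    rw [← integral_mul_right_eq_self _ h]
    simp
  simp only [e]
  rw [integral_integral_swap (integrable_of_continuous (by unfold Function.uncurry; fun_prop))]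
  simp only [integral_mul_const]

theorem character_identity {f : SU2 × SU2 → ℂ} (hf : Continuous f) :
    Tendsto (fun r : ℝ => ∑' n : ℕ, ((n : ℂ) + 1) *
        (∫ p, f p * chi n (p.1 * p.2⁻¹) ∂(haar.prod haar)) * (r : ℂ) ^ n)
      (𝓝[<] 1) (𝓝 (∫ h, f (h, h) ∂haar)) := by
  have h := tendsto_tsum_integral_mul_chi (F := fun x => ∫ h, f (x * h, h) ∂haar)
    (continuous_integral (by unfold Function.uncurry; fun_prop))
  simpa only [integral_prod_mul_chi hf, one_mul] using h

end SU2

/-! ### The truncated delta function -/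

namespace SU2

open Filter Topology

theorem tr_inv (g : SU2) : tr g⁻¹ = tr g := by
  have : (tr g⁻¹ : ℂ) = tr g := by
    rw [coe_tr, coe_tr, inv_val_eq_adjugate, Matrix.adjugate_fin_two]
    simp [add_comm]
  exact_mod_cast this

theorem chi_inv (n : ℕ) (g : SU2) : chi n g⁻¹ = chi n g := by
  induction n using Nat.twoStepInduction with
  | zero => rw [chi_zero, chi_zero]
  | one => rw [chi_one, chi_one, tr_inv]
  | more n h1 h2 => rw [chi_add_two, chi_add_two, tr_inv, h1, h2]

/-- The truncated delta function `∑_{n < N} (n + 1) χ_n`. -/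
noncomputable def truncDelta (N : ℕ) (g : SU2) : ℂ :=
  ∑ n ∈ Finset.range N, ((n : ℂ) + 1) * chi n g

@[fun_prop]
theorem continuous_truncDelta (N : ℕ) : Continuous (truncDelta N) := by
  unfold truncDelta
  fun_prop

theorem truncDelta_inv (N : ℕ) (g : SU2) : truncDelta N g⁻¹ = truncDelta N g := by
  simp only [truncDelta, chi_inv]

/-- The truncated delta function reproduces the value at `1` of polynomials of degree less than
`N`. -/
theorem integral_truncDelta_mul {D N : ℕ} (hN : D < N) {F : SU2 → ℂ} (hF : F ∈ polyLE D) :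
    ∫ g, truncDelta N g * F g ∂haar = F 1 := by
  have hFc := continuous_of_mem_polyLE hF
  rw [← sum_integral_mul_chi hN hF]
  simp only [truncDelta, Finset.sum_mul]
  rw [integral_finsetSum _ fun n _ => integrable_of_continuous (by fun_prop)]
  refine Finset.sum_congr rfl fun n _ => ?_
  rw [← integral_const_mul]
  congr 1
  ext g
  ring

/-! ### Functions of several group variables -/

section Shift

variable {V : Type*}

/-- Left translation by `x` of the variables in `S`. -/
noncomputable def shift (S : Set V) (x : SU2) (h : V → SU2) : V → SU2 :=
  S.mulIndicator (fun _ => x) * h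

theorem shift_of_mem {S : Set V} {v : V} (hv : v ∈ S) (x : SU2) (h : V → SU2) :
    shift S x h v = x * h v := by
  simp [shift, hv]

theorem shift_of_notMem {S : Set V} {v : V} (hv : v ∉ S) (x : SU2) (h : V → SU2) :
    shift S x h v = h v := by
  simp [shift, hv]

@[fun_prop]
theorem continuous_shift (S : Set V) :
    Continuous fun p : SU2 × (V → SU2) => shift S p.1 p.2 := by
  refine continuous_pi fun v => ?_
  by_cases hv : v ∈ S
  · simp only [shift_of_mem hv]; fun_prop
  · simp only [shift_of_notMem hv]; fun_prop

/-- A continuous function of several variables in `SU(2)` that is a polynomial of degree at most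
`D` in `x` whenever any set of its variables is translated by `x`. -/
structure IsPolyLE (D : ℕ) (G : (V → SU2) → ℂ) : Prop where
  continuous : Continuous G
  mem_polyLE : ∀ (S : Set V) (h : V → SU2), (fun x => G (shift S x h)) ∈ polyLE D

/-- Translating some variables before a renaming `ρ` translates their preimage under `ρ`. -/
theorem IsPolyLE.comp {D : ℕ} {W : Type*} {G : (W → SU2) → ℂ} (hG : IsPolyLE D G) (ρ : W → V) :
    IsPolyLE D fun h : V → SU2 => G (h ∘ ρ) where
  continuous := hG.continuous.comp (by fun_prop)
  mem_polyLE S h := by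
    have e (x : SU2) : shift S x h ∘ ρ = shift (ρ ⁻¹' S) x (h ∘ ρ) := by
      ext1 w
      by_cases hw : ρ w ∈ S
      · rw [Function.comp_apply, shift_of_mem hw, shift_of_mem (show w ∈ ρ ⁻¹' S from hw)]
        rfl
      · rw [Function.comp_apply, shift_of_notMem hw, shift_of_notMem (show w ∉ ρ ⁻¹' S from hw)]
        rfl
    simpa only [e] using hG.mem_polyLE (ρ ⁻¹' S) (h ∘ ρ)

theorem IsPolyLE.prod {ι : Type*} (s : Finset ι) {D : ι → ℕ} {G : ι → (V → SU2) → ℂ}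
    (hG : ∀ i ∈ s, IsPolyLE (D i) (G i)) :
    IsPolyLE (∑ i ∈ s, D i) fun h => ∏ i ∈ s, G i h where
  continuous := continuous_finsetProd _ fun i hi => (hG i hi).continuous
  mem_polyLE S h := prod_mem_polyLE s fun i hi => (hG i hi).mem_polyLE S h

theorem IsPolyLE.const_mul {D : ℕ} {G : (V → SU2) → ℂ} (hG : IsPolyLE D G) (c : ℂ) :
    IsPolyLE D fun h => c * G h where
  continuous := continuous_const.mul hG.continuous
  mem_polyLE S h := (polyLE D).smul_mem c (hG.mem_polyLE S h)

/-- Translating both ends of an edge conjugates the argument of its character. -/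
theorem chi_shift_of_iff {S : Set V} {a b : V} (hab : a ∈ S ↔ b ∈ S) (n : ℕ) (x : SU2)
    (h : V → SU2) : chi n (shift S x h a * (shift S x h b)⁻¹) = chi n (h a * (h b)⁻¹) := by
  by_cases ha : a ∈ S
  · rw [shift_of_mem ha, shift_of_mem (hab.mp ha), ← chi_conj n x (h a * (h b)⁻¹)]
    congr 1
    group
  · rw [shift_of_notMem ha, shift_of_notMem fun hb => ha (hab.mpr hb)]

theorem isPolyLE_chi (n : ℕ) (a b : V) :
    IsPolyLE n fun h : V → SU2 => chi n (h a * (h b)⁻¹) where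
  continuous := by fun_prop
  mem_polyLE S h := by
    by_cases ha : a ∈ S <;> by_cases hb : b ∈ S
    · simpa only [chi_shift_of_iff (iff_of_true ha hb)] using const_mem_polyLE _ _
    · simp only [shift_of_mem ha, shift_of_notMem hb, mul_assoc]
      exact mul_right_mem_polyLE (chi_mem_polyLE n) _
    · simp only [shift_of_notMem ha, shift_of_mem hb, mul_inv_rev]
      simp only [← mul_assoc]
      exact inv_mem_polyLE (mul_left_mem_polyLE (chi_mem_polyLE n) (h a * (h b)⁻¹))
    · simpa only [chi_shift_of_iff (iff_of_false ha hb)] using const_mem_polyLE _ _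

variable [Fintype V]

/-- The product of the normalised Haar measures. -/
noncomputable abbrev haarPi (V : Type*) [Fintype V] : Measure (V → SU2) :=
  Measure.pi fun _ : V => haar

/-- Forgetting some of the variables, and renaming the others, preserves the Haar measure. -/
theorem integral_comp_injective {W : Type*} [Fintype W] {j : W → V} (hj : Function.Injective j)
    {G : (W → SU2) → ℂ} (hG : Continuous G) :
    ∫ h, G (h ∘ j) ∂haarPi V = ∫ h, G h ∂haarPi W := by
  have hmp : MeasurePreserving (MonoidHom.pi fun w => Pi.evalMonoidHom (fun _ : V => SU2) (j w))
      (haarPi V) (haarPi W) := by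
    refine MonoidHom.measurePreserving ?_ ?_ (by simp)
    · exact continuous_pi fun w => continuous_apply (j w)
    · intro g
      obtain ⟨h, hh⟩ := hj.surjective_comp_right (γ := SU2) g
      exact ⟨h, hh⟩
  rw [← hmp.map_eq, integral_map hmp.measurable.aemeasurable
    hG.measurable.aestronglyMeasurable]
  rfl

/-- If the edge from `a` to `b` is the only one that leaves the set `S`, then the variable of that
edge can be integrated separately: it acts by translation of the variables in `S`. -/
theorem integral_cut {S : Set V} {a b : V} (ha : a ∈ S) (hb : b ∉ S) {φ : SU2 → ℂ}
    (hφ : Continuous φ) {R G : (V → SU2) → ℂ} (hR : Continuous R)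
    (hRS : ∀ x h, R (shift S x h) = R h) (hG : Continuous G) :
    ∫ h, φ (h a * (h b)⁻¹) * (R h * G h) ∂haarPi V =
      ∫ h, R h * ∫ x, φ x * G (shift S (x * (h b * (h a)⁻¹)) h) ∂haar ∂haarPi V := by
  set H : (V → SU2) → ℂ := fun h => φ (h a * (h b)⁻¹) * (R h * G h) with hH
  have hHc : Continuous H := by fun_prop
  have h1 (x : SU2) : ∫ h, H (shift S x h) ∂haarPi V = ∫ h, H h ∂haarPi V :=
    integral_mul_left_eq_self H _
  calc ∫ h, H h ∂haarPi V = ∫ x, ∫ h, H (shift S x h) ∂haarPi V ∂haar := by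
        simp [h1]
    _ = ∫ h, ∫ x, H (shift S x h) ∂haar ∂haarPi V :=
        integral_integral_swap (integrable_of_continuous
          (hHc.comp (continuous_shift S)))
    _ = _ := by
        congr 1
        ext h
        rw [← integral_mul_right_eq_self _ (h b * (h a)⁻¹), ← integral_const_mul]
        congr 1
        ext x
        simp only [hH, shift_of_mem ha, shift_of_notMem hb, hRS]
        rw [show x * (h b * (h a)⁻¹) * h a * (h b)⁻¹ = x by group]
        ring

/-- The spin of an edge that is the only one to leave a set of vertices is bounded by the degree of
the remaining integrand. -/
theorem integral_chi_cut_eq_zero {S : Set V} {a b : V} (ha : a ∈ S) (hb : b ∉ S)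
    {R G : (V → SU2) → ℂ} (hR : Continuous R) (hRS : ∀ x h, R (shift S x h) = R h)
    {D n : ℕ} (hG : IsPolyLE D G) (hn : D < n) :
    ∫ h, chi n (h a * (h b)⁻¹) * (R h * G h) ∂haarPi V = 0 := by
  rw [integral_cut ha hb (continuous_chi n) hR hRS hG.continuous]
  have e (h : V → SU2) : ∫ x, chi n x * G (shift S (x * (h b * (h a)⁻¹)) h) ∂haar = 0 := by
    simp only [mul_comm (chi n _)]
    exact integral_mul_chi_eq_zero hn (mul_right_mem_polyLE (hG.mem_polyLE S h) _)
  simp [e]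

/-- The truncated delta function sets the variable of `a` equal to that of `b`. -/
theorem integral_truncDelta_edge [DecidableEq V] {a b : V} (hab : a ≠ b)
    {R G : (V → SU2) → ℂ} (hR : Continuous R) (hRS : ∀ x h, R (shift {a} x h) = R h)
    {D N : ℕ} (hG : IsPolyLE D G) (hN : D < N) :
    ∫ h, truncDelta N (h a * (h b)⁻¹) * (R h * G h) ∂haarPi V =
      ∫ h, R h * G (h ∘ Function.update id a b) ∂haarPi V := by
  have ha : a ∈ ({a} : Set V) := rfl
  have hb : b ∉ ({a} : Set V) := fun h => hab h.symm
  rw [integral_cut ha hb (continuous_truncDelta N) hR hRS hG.continuous]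
  congr 1
  ext h
  rw [integral_truncDelta_mul hN (mul_right_mem_polyLE (hG.mem_polyLE {a} h) _)]
  congr 2
  ext1 v
  rcases eq_or_ne v a with rfl | hv
  · rw [shift_of_mem ha]
    simp
  · rw [shift_of_notMem (show v ∉ ({a} : Set V) from hv)]
    simp [hv]

/-- Truncated delta functions along the edges of a rooted forest, the edge `f` of which joins a
vertex `c f` to its parent `p f`, identify the variables of all the vertices of each tree. The edges
are integrated out from the leaves to the roots. -/
theorem exists_integral_truncDelta_forest [DecidableEq V] {F : Type*} [DecidableEq F]
    {c p : F → V} (hc : Function.Injective c) (depth : V → ℕ)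
    (hdepth : ∀ f, depth (p f) < depth (c f)) (s : Finset F) :
    ∃ ρ : V → V, (∀ v, v ∉ c '' s → ρ v = v) ∧ (∀ f ∈ s, ρ (c f) = ρ (p f)) ∧
      ∀ {D N : ℕ} {G : (V → SU2) → ℂ}, IsPolyLE D G → D < N →
        ∫ h, (∏ f ∈ s, truncDelta N (h (c f) * (h (p f))⁻¹)) * G h ∂haarPi V =
          ∫ h, G (h ∘ ρ) ∂haarPi V := by
  induction s using Finset.induction_on_max_value (fun f => depth (c f)) with
  | empty => exact ⟨id, by simp, by simp, by simp⟩
  | insert f₀ s hf₀ hmax ih =>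
    obtain ⟨ρ, hρ1, hρ2, hρ3⟩ := ih
    have hcp : ∀ f, p f ≠ c f := fun f h => (hdepth f).ne (congrArg depth h)
    have hcne : ∀ f ∈ s, c f ≠ c f₀ := fun f hf h => hf₀ (hc h ▸ hf)
    -- the deepest child `c f₀` is a leaf among the remaining edges
    have hpne : ∀ f ∈ s, p f ≠ c f₀ := fun f hf h => by
      have h1 := hdepth f
      have h2 := hmax f hf
      rw [h] at h1
      omega
    refine ⟨ρ ∘ Function.update id (c f₀) (p f₀), ?_, ?_, ?_⟩
    · intro v hv
      have hv0 : v ≠ c f₀ := by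
        rintro rfl
        exact hv ⟨f₀, by simp, rfl⟩
      simp only [Function.comp_apply, Function.update_of_ne hv0, id]
      refine hρ1 v fun ⟨f, hf, hfv⟩ => hv ⟨f, by simp [Finset.mem_coe.mp hf], hfv⟩
    · intro f hf
      rcases Finset.mem_insert.mp hf with rfl | hf
      · simp [Function.update_of_ne (hcp f)]
      · simp only [Function.comp_apply, Function.update_of_ne (hcne f hf),
          Function.update_of_ne (hpne f hf), id, hρ2 f hf]
    · intro D N G hG hN
      simp only [Finset.prod_insert hf₀, mul_assoc]
      rw [integral_truncDelta_edge (hcp f₀).symm (by fun_prop) ?_ hG hN]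
      · rw [hρ3 (hG.comp _) hN]
        rfl
      · intro x h
        refine Finset.prod_congr rfl fun f hf => ?_
        rw [shift_of_notMem (show c f ∉ ({c f₀} : Set V) from hcne f hf),
          shift_of_notMem (show p f ∉ ({c f₀} : Set V) from hpne f hf)]

end Shift

end SU2

/-! ### Contraction of an edge -/

namespace CellGraph

open SU2

variable {V E W F : Type*}

/-- The product of the edge weights of a labelled graph, as a function of the variables at the
vertices. -/
noncomputable def weight [Fintype E] (Γ : CellGraph V E) (spin : E → ℕ) (h : V → SU2) : ℂ :=
  ∏ e : E, (-1 : ℂ) ^ spin e * chi (spin e) (h (Γ.ends e 0) * (h (Γ.ends e 1))⁻¹)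

theorem invariant_eq_integral_weight [Fintype V] [Fintype E] (Γ : CellGraph V E) (spin : E → ℕ) :
    Γ.invariant spin = ∫ h, Γ.weight spin h ∂haarPi V := by
  unfold invariant weight
  rw [Subsingleton.elim (Fintype.ofFinite V) ‹_›, Subsingleton.elim (Fintype.ofFinite E) ‹_›]

theorem isPolyLE_weight [Fintype E] (Γ : CellGraph V E) (spin : E → ℕ) :
    IsPolyLE (∑ e, spin e) (Γ.weight spin) :=
  IsPolyLE.prod _ fun e _ => (isPolyLE_chi (spin e) _ _).const_mul _

theorem prod_eq_mul_prod_ne [Fintype E] [DecidableEq E] (e₀ : E) (f : E → ℂ) :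
    ∏ e, f e = f e₀ * ∏ e : {e : E // e ≠ e₀}, f e := by
  rw [← Fintype.prod_subtype_mul_prod_subtype (· = e₀)]
  simp only [Finset.univ_unique, Finset.prod_singleton]
  rfl

/-- The factorisation of the weight of a graph, with the edge `e₀` separated. -/
theorem weight_update [Fintype E] [DecidableEq E] (Γ : CellGraph V E) (e₀ : E) (spin : E → ℕ)
    (n : ℕ) (h : V → SU2) :
    Γ.weight (Function.update spin e₀ n) h =
      (-1) ^ n * (chi n (h (Γ.ends e₀ 0) * (h (Γ.ends e₀ 1))⁻¹) *
        (1 * (⟨fun e : {e : E // e ≠ e₀} => Γ.ends e⟩ : CellGraph V _).weight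
          (fun e => spin e) h)) := by
  rw [weight, prod_eq_mul_prod_ne e₀, Function.update_self, mul_assoc, one_mul]
  congr 2
  refine Finset.prod_congr rfl fun e _ => ?_
  rw [Function.update_of_ne e.2]

theorem contraction [Finite V] [Finite E] [DecidableEq E] (Γ : CellGraph V E) (e₀ : E)
    (hne : Γ.ends e₀ 0 ≠ Γ.ends e₀ 1) (spin : E → ℕ) :
    {n : ℕ | Γ.invariant (Function.update spin e₀ n) ≠ 0}.Finite ∧
      HasSum (fun n : ℕ => (-1 : ℂ) ^ n * ((n : ℂ) + 1) *
        Γ.invariant (Function.update spin e₀ n)) ((Γ.contract e₀).invariant fun e => spin e) := by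
  classical
  have := Fintype.ofFinite V
  have := Fintype.ofFinite E
  set Γ' : CellGraph V {e : E // e ≠ e₀} := ⟨fun e => Γ.ends e⟩ with hΓ'
  set D := ∑ e : {e : E // e ≠ e₀}, spin e with hD
  have hG : IsPolyLE D (Γ'.weight fun e => spin e) := isPolyLE_weight Γ' _
  have hI (n : ℕ) : Γ.invariant (Function.update spin e₀ n) =
      (-1) ^ n * ∫ h, chi n (h (Γ.ends e₀ 0) * (h (Γ.ends e₀ 1))⁻¹) *
        (1 * Γ'.weight (fun e => spin e) h) ∂haarPi V := by
    rw [invariant_eq_integral_weight, ← integral_const_mul]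
    simp only [weight_update, hΓ']
  have hzero (n : ℕ) (hn : D < n) : Γ.invariant (Function.update spin e₀ n) = 0 := by
    rw [hI, integral_chi_cut_eq_zero (S := {Γ.ends e₀ 0}) rfl (fun h => hne h.symm)
      continuous_const (fun _ _ => rfl) hG hn, mul_zero]
  refine ⟨(Set.finite_Iic D).subset fun n hn => ?_, ?_⟩
  · by_contra hcon
    exact hn (hzero n (by simpa using hcon))
  have hsum := hasSum_sum_of_ne_finset_zero
    (L := SummationFilter.unconditional ℕ) (s := Finset.range (D + 1))
    (f := fun n : ℕ => (-1 : ℂ) ^ n * ((n : ℂ) + 1) *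
      Γ.invariant (Function.update spin e₀ n)) fun n hn => by
        rw [hzero n (by simp at hn; omega), mul_zero]
  convert hsum using 1
  set s : V → V := Function.update id (Γ.ends e₀ 0) (Γ.ends e₀ 1) with hs
  have hs0 : s (Γ.ends e₀ 0) = Γ.ends e₀ 1 := by simp [hs]
  have hs1 : s (Γ.ends e₀ 1) = Γ.ends e₀ 1 := by simp [hs, Function.update_of_ne hne.symm]
  have hrange : ∀ v ∈ Set.range (Γ.ends e₀), s v = Γ.ends e₀ 1 := by
    rintro _ ⟨i, rfl⟩
    fin_cases i
    · exact hs0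
    · exact hs1
  have hs_ne : ∀ v, v ∉ Set.range (Γ.ends e₀) → s v = v := fun v hv => by
    rw [hs, Function.update_of_ne fun h => hv ⟨0, h.symm⟩, id]
  -- `s` descends to a section of the quotient map on vertices
  set σ : Quotient (Γ.endsSetoid e₀) → V := Quotient.lift s (by
    rintro x y (rfl | ⟨hx, hy⟩)
    · rfl
    · rw [hrange x hx, hrange y hy]) with hσ
  have hσinj : Function.Injective σ := by
    rintro ⟨x⟩ ⟨y⟩ (hxy : s x = s y)
    refine Quotient.sound ?_
    by_cases hx : x ∈ Set.range (Γ.ends e₀) <;> by_cases hy : y ∈ Set.range (Γ.ends e₀)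
    · exact Or.inr ⟨hx, hy⟩
    · rw [hrange x hx, hs_ne y hy] at hxy
      exact absurd ⟨1, hxy⟩ hy
    · rw [hrange y hy, hs_ne x hx] at hxy
      exact absurd ⟨1, hxy.symm⟩ hx
    · rw [hs_ne x hx, hs_ne y hy] at hxy
      exact Or.inl hxy
  have hl : (Γ.contract e₀).invariant (fun e => spin e) =
      ∫ h, 1 * Γ'.weight (fun e => spin e) (h ∘ s) ∂haarPi V := by
    have := Fintype.ofFinite (Quotient (Γ.endsSetoid e₀))
    rw [invariant_eq_integral_weight, ← integral_comp_injective hσinj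
      (isPolyLE_weight _ _).continuous]
    simp only [one_mul]
    rfl
  rw [hl, ← integral_truncDelta_edge hne continuous_const (fun _ _ => rfl) hG (Nat.lt_succ_self D)]
  simp only [truncDelta, Finset.sum_mul]
  have hGc := hG.continuous
  rw [integral_finsetSum _ fun n _ => integrable_of_continuous (by fun_prop)]
  refine Finset.sum_congr rfl fun n _ => ?_
  have hsign : (-1 : ℂ) ^ n * (-1) ^ n = 1 := by rw [← mul_pow]; simp
  rw [hI]
  simp only [mul_assoc]
  rw [integral_const_mul]
  linear_combination (-((n : ℂ) + 1) * ∫ h, chi n (h (Γ.ends e₀ 0) * (h (Γ.ends e₀ 1))⁻¹) *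
        (1 * Γ'.weight (fun e => spin e) h) ∂haarPi V) * hsign

/-! ### Trees -/

/-- Every edge of a tree is a bridge. -/
theorem IsTree.exists_cut {T : CellGraph W F} (hT : T.IsTree) (f : F) :
    ∃ S : Set W, T.ends f 0 ∈ S ∧ T.ends f 1 ∉ S ∧
      ∀ f', f' ≠ f → (T.ends f' 0 ∈ S ↔ T.ends f' 1 ∈ S) := by
  obtain ⟨hloop, hinj, htree⟩ := hT
  set G := SimpleGraph.fromEdgeSet (Set.range fun f => s(T.ends f 0, T.ends f 1)) with hG
  have hadj (f : F) : G.Adj (T.ends f 0) (T.ends f 1) := by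
    rw [hG, SimpleGraph.fromEdgeSet_adj]
    exact ⟨⟨f, rfl⟩, hloop f⟩
  have hbr := SimpleGraph.isBridge_iff.mp
    (SimpleGraph.isAcyclic_iff_forall_adj_isBridge.mp htree.isAcyclic (hadj f))
  refine ⟨{w | (G.deleteEdges {s(T.ends f 0, T.ends f 1)}).Reachable (T.ends f 0) w},
    SimpleGraph.Reachable.refl _, hbr, fun f' hf' => ?_⟩
  have had : (G.deleteEdges {s(T.ends f 0, T.ends f 1)}).Adj (T.ends f' 0) (T.ends f' 1) := by
    rw [SimpleGraph.deleteEdges_adj]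
    exact ⟨hadj f', fun h => hf' (hinj h)⟩
  exact ⟨fun h => h.trans had.reachable, fun h => h.trans had.symm.reachable⟩

/-- A function on the vertices of a tree that is constant along edges is constant. -/
theorem IsTree.eq_of_forall_ends_eq {T : CellGraph W F} (hT : T.IsTree) {α : Type*} {ρ : W → α}
    (hρ : ∀ f, ρ (T.ends f 0) = ρ (T.ends f 1)) (w w' : W) : ρ w = ρ w' := by
  obtain ⟨p⟩ := hT.2.2.connected.preconnected w w'
  induction p with
  | nil => rfl
  | cons h _ ih =>
    rw [← ih]
    rw [SimpleGraph.fromEdgeSet_adj] at h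
    obtain ⟨⟨f, hf⟩, -⟩ := h
    rcases Sym2.eq_iff.mp hf with ⟨h0, h1⟩ | ⟨h0, h1⟩
    · rw [← h0, ← h1, hρ]
    · rw [← h0, ← h1, hρ]

/-- A tree can be rooted: every edge joins a child to its parent, and a vertex is the child in at
most one edge. -/
theorem IsTree.exists_root {T : CellGraph W F} (hT : T.IsTree) :
    ∃ (r : W) (depth : W → ℕ) (c p : F → W), Function.Injective c ∧
      (∀ f, depth (p f) < depth (c f)) ∧ (∀ f, c f ≠ r) ∧
      ∀ f, (T.ends f 0 = c f ∧ T.ends f 1 = p f) ∨ (T.ends f 0 = p f ∧ T.ends f 1 = c f) := by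
  obtain ⟨hloop, hinj, htree⟩ := hT
  set G := SimpleGraph.fromEdgeSet (Set.range fun f => s(T.ends f 0, T.ends f 1)) with hG
  have hadj (f : F) : G.Adj (T.ends f 0) (T.ends f 1) := by
    rw [hG, SimpleGraph.fromEdgeSet_adj]
    exact ⟨⟨f, rfl⟩, hloop f⟩
  obtain ⟨r⟩ := htree.connected.nonempty
  have hex (f : F) : ∃ c p : W, G.dist r c = G.dist r p + 1 ∧
      ((T.ends f 0 = c ∧ T.ends f 1 = p) ∨ (T.ends f 0 = p ∧ T.ends f 1 = c)) := by
    rcases htree.dist_eq_dist_add_one_of_adj r (hadj f) with h | h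
    · exact ⟨_, _, h, Or.inl ⟨rfl, rfl⟩⟩
    · exact ⟨_, _, h, Or.inr ⟨rfl, rfl⟩⟩
  choose c p hdist hends using hex
  have hsym (f : F) : s(T.ends f 0, T.ends f 1) = s(p f, c f) := by
    rcases hends f with ⟨h0, h1⟩ | ⟨h0, h1⟩
    · rw [h0, h1, Sym2.eq_swap]
    · rw [h0, h1]
  have hpc (f : F) : G.Adj (p f) (c f) := by
    rw [← SimpleGraph.mem_edgeSet, ← hsym]
    exact hadj f
  -- a shortest path to the parent, continued to the child, is the only path to the child
  have hpath (f : F) : ∃ q : G.Walk r (c f), q.IsPath ∧ q.penultimate = p f := by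
    obtain ⟨q, hq⟩ := htree.connected.exists_walk_length_eq_dist r (p f)
    refine ⟨q.concat (hpc f), SimpleGraph.Walk.isPath_of_length_eq_dist _ ?_,
      q.penultimate_concat _⟩
    rw [SimpleGraph.Walk.length_concat, hq, hdist]
  refine ⟨r, G.dist r, c, p, fun f f' hff => ?_, fun f => by rw [hdist]; omega, fun f hf => ?_,
    hends⟩
  · obtain ⟨q, hq, hqp⟩ := hpath f
    obtain ⟨q', hq', hqp'⟩ := hpath f'
    have hpp : p f = p f' := by
      rw [← hqp, ← hqp']
      generalize c f' = w at hff q' hq'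
      subst hff
      rw [(htree.existsUnique_path r _).unique hq hq']
    refine hinj ?_
    change s(T.ends f 0, T.ends f 1) = s(T.ends f' 0, T.ends f' 1)
    rw [hsym, hsym, hff, hpp]
  · have := hdist f
    rw [hf, SimpleGraph.dist_self] at this
    omega


/-! ### Expansion of a vertex as a tree -/

/-- The factorisation of the weight of an expansion, with the edges of the tree collected. -/
theorem weight_expand [Fintype E] [Fintype F] (Γ : CellGraph V E) (v : V) (T : CellGraph W F)
    (attach : E → Fin 2 → W) (spin : E → ℕ) (m : F → ℕ) (h : {u : V // u ≠ v} ⊕ W → SU2) :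
    (Γ.expand v T attach).weight (Sum.elim spin m) h =
      (∏ f, (-1 : ℂ) ^ m f) *
        ((∏ f, chi (m f) (h (Sum.inr (T.ends f 0)) * (h (Sum.inr (T.ends f 1)))⁻¹)) *
          (⟨fun e => (Γ.expand v T attach).ends (Sum.inl e)⟩ : CellGraph _ E).weight spin h) := by
  rw [weight, Fintype.prod_sum_type, ← mul_assoc, ← Finset.prod_mul_distrib, mul_comm]
  rfl

theorem tree_expansion [Finite V] [Finite E] [Finite W] [Fintype F]
    (Γ : CellGraph V E) (v : V) (T : CellGraph W F) (hT : T.IsTree) (attach : E → Fin 2 → W)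
    (spin : E → ℕ) :
    {m : F → ℕ | (Γ.expand v T attach).invariant (Sum.elim spin m) ≠ 0}.Finite ∧
      HasSum (fun m : F → ℕ => (∏ f, (-1 : ℂ) ^ m f * ((m f : ℂ) + 1)) *
        (Γ.expand v T attach).invariant (Sum.elim spin m)) (Γ.invariant spin) := by
  classical
  have := Fintype.ofFinite V
  have := Fintype.ofFinite E
  have := Fintype.ofFinite W
  set Γ' : CellGraph ({u : V // u ≠ v} ⊕ W) E :=
    ⟨fun e => (Γ.expand v T attach).ends (Sum.inl e)⟩ with hΓ'
  set D := ∑ e, spin e with hD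
  have hG : IsPolyLE D (Γ'.weight spin) := isPolyLE_weight Γ' _
  have hGc := hG.continuous
  have hI (m : F → ℕ) : (Γ.expand v T attach).invariant (Sum.elim spin m) =
      (∏ f, (-1 : ℂ) ^ m f) *
        ∫ h, (∏ f, chi (m f) (h (Sum.inr (T.ends f 0)) * (h (Sum.inr (T.ends f 1)))⁻¹)) *
          Γ'.weight spin h ∂haarPi _ := by
    rw [invariant_eq_integral_weight, ← integral_const_mul]
    simp only [weight_expand, hΓ']
  have hzero (m : F → ℕ) (f : F) (hf : D < m f) :
      (Γ.expand v T attach).invariant (Sum.elim spin m) = 0 := by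
    obtain ⟨S, h0, h1, hS⟩ := hT.exists_cut f
    have h0' : Sum.inr (T.ends f 0) ∈ (Sum.inr '' S : Set ({u : V // u ≠ v} ⊕ W)) := ⟨_, h0, rfl⟩
    have h1' : Sum.inr (T.ends f 1) ∉ (Sum.inr '' S : Set ({u : V // u ≠ v} ⊕ W)) := by
      simpa using h1
    have hz := integral_chi_cut_eq_zero h0' h1'
      (R := fun h => ∏ f' : {f' : F // f' ≠ f},
        chi (m f') (h (Sum.inr (T.ends f' 0)) * (h (Sum.inr (T.ends f' 1)))⁻¹))
      (by fun_prop) (fun x h => Finset.prod_congr rfl fun f' _ =>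
        chi_shift_of_iff (by simpa using hS f' f'.2) _ _ _) hG hf
    simp only [← mul_assoc] at hz
    rw [hI]
    simp only [prod_eq_mul_prod_ne f (fun f => chi (m f) _)]
    rw [hz, mul_zero]
  refine ⟨(Set.Finite.pi' fun _ : F => Set.finite_Iic D).subset fun m hm f => ?_, ?_⟩
  · by_contra hcon
    exact hm (hzero m f (by simpa using hcon))
  have hsum := hasSum_sum_of_ne_finset_zero (L := SummationFilter.unconditional _)
    (s := Fintype.piFinset fun _ : F => Finset.range (D + 1))
    (f := fun m : F → ℕ => (∏ f, (-1 : ℂ) ^ m f * ((m f : ℂ) + 1)) *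
        (Γ.expand v T attach).invariant (Sum.elim spin m)) fun m hm => by
      simp only [Fintype.mem_piFinset, not_forall, Finset.mem_range, not_lt] at hm
      obtain ⟨f, hf⟩ := hm
      rw [hzero m f hf, mul_zero]
  convert hsum using 1
  -- the sum over the box is an integral against truncated delta functions along the tree
  have hbox : ∑ m ∈ Fintype.piFinset fun _ : F => Finset.range (D + 1),
      (∏ f, (-1 : ℂ) ^ m f * ((m f : ℂ) + 1)) *
        (Γ.expand v T attach).invariant (Sum.elim spin m) =
      ∫ h, (∏ f, truncDelta (D + 1)
        (h (Sum.inr (T.ends f 0)) * (h (Sum.inr (T.ends f 1)))⁻¹)) *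
          Γ'.weight spin h ∂haarPi ({u : V // u ≠ v} ⊕ W) := by
    simp only [truncDelta, Finset.prod_univ_sum, Finset.sum_mul]
    rw [integral_finsetSum _ fun m _ => integrable_of_continuous (by fun_prop)]
    refine Finset.sum_congr rfl fun m _ => ?_
    have hsign : (∏ f, (-1 : ℂ) ^ m f) * ∏ f, (-1 : ℂ) ^ m f = 1 := by
      rw [← Finset.prod_mul_distrib]
      exact Finset.prod_eq_one fun f _ => by rw [← mul_pow]; simp
    rw [hI, Finset.prod_mul_distrib]
    simp only [Finset.prod_mul_distrib, mul_assoc]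
    rw [integral_const_mul]
    linear_combination ((∏ f, ((m f : ℂ) + 1)) *
      ∫ h, (∏ f, chi (m f) (h (Sum.inr (T.ends f 0)) * (h (Sum.inr (T.ends f 1)))⁻¹)) *
          Γ'.weight spin h ∂haarPi ({u : V // u ≠ v} ⊕ W)) * hsign
  rw [hbox]
  obtain ⟨r, depth, c, p, hc, hdepth, hcr, hends⟩ := hT.exists_root
  obtain ⟨ρ, hρ1, hρ2, hρ3⟩ := exists_integral_truncDelta_forest
    (V := {u : V // u ≠ v} ⊕ W) (c := Sum.inr ∘ c) (p := Sum.inr ∘ p)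
    (Sum.inr_injective.comp hc) (Sum.elim 0 depth) hdepth Finset.univ
  have horient (h : {u : V // u ≠ v} ⊕ W → SU2) (f : F) : truncDelta (D + 1)
      (h (Sum.inr (T.ends f 0)) * (h (Sum.inr (T.ends f 1)))⁻¹) =
      truncDelta (D + 1) (h ((Sum.inr ∘ c) f) * (h ((Sum.inr ∘ p) f))⁻¹) := by
    rcases hends f with ⟨h0, h1⟩ | ⟨h0, h1⟩
    · rw [h0, h1]; rfl
    · rw [h0, h1, ← truncDelta_inv, mul_inv_rev, inv_inv]; rfl
  simp only [horient]
  rw [hρ3 hG (Nat.lt_succ_self D)]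
  have hρinl (u : {u : V // u ≠ v}) : ρ (Sum.inl u) = Sum.inl u := hρ1 _ (by simp)
  have hρinr (w : W) : ρ (Sum.inr w) = Sum.inr r := by
    rw [hT.eq_of_forall_ends_eq (ρ := fun w => ρ (Sum.inr w)) (fun f => ?_) w r]
    · exact hρ1 _ (by simpa using hcr)
    · have := hρ2 f (Finset.mem_univ f)
      rcases hends f with ⟨h0, h1⟩ | ⟨h0, h1⟩
      · rw [h0, h1]; exact this
      · rw [h0, h1]; exact this.symm
  -- the vertex `v` of `Γ` corresponds to the root
  set j : V → {u : V // u ≠ v} ⊕ W :=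
    fun u => if hu : u = v then Sum.inr r else Sum.inl ⟨u, hu⟩ with hj
  have hjinj : Function.Injective j := by
    intro x y hxy
    by_cases hx : x = v <;> by_cases hy : y = v
    · rw [hx, hy]
    · simp [hj, hx, hy] at hxy
    · simp [hj, hx, hy] at hxy
    · simpa [hj, hx, hy] using hxy
  rw [invariant_eq_integral_weight, ← integral_comp_injective hjinj
    (isPolyLE_weight _ _).continuous]
  have hend (e : E) (i : Fin 2) : ρ (Γ'.ends e i) = j (Γ.ends e i) := by
    change ρ (if h : Γ.ends e i = v then Sum.inr (attach e i) else Sum.inl ⟨Γ.ends e i, h⟩) = _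
    by_cases h : Γ.ends e i = v
    · rw [dif_pos h, hρinr, hj]; simp [h]
    · rw [dif_neg h, hρinl, hj]; simp [h]
  simp only [weight, Function.comp_apply, hend]

end CellGraph

/-! ### The three identities -/

theorem mainTheorem2 :
    -- the contraction formula
    (∀ (V E : Type*) [Finite V] [Finite E] [DecidableEq E] (Γ : CellGraph V E) (e₀ : E),
      Γ.ends e₀ 0 ≠ Γ.ends e₀ 1 →
      ∀ spin : E → ℕ,
        {n : ℕ | Γ.invariant (Function.update spin e₀ n) ≠ 0}.Finite ∧
        HasSum (fun n : ℕ => (-1 : ℂ) ^ n * ((n : ℂ) + 1) *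
            Γ.invariant (Function.update spin e₀ n))
          ((Γ.contract e₀).invariant fun e => spin e)) ∧
    -- the expansion of a vertex as a tree
    (∀ (V E W F : Type*) [Finite V] [Finite E] [Finite W] [Fintype F]
      (Γ : CellGraph V E) (v : V) (T : CellGraph W F),
      T.IsTree →
      ∀ (attach : E → Fin 2 → W) (spin : E → ℕ),
        {m : F → ℕ | (Γ.expand v T attach).invariant (Sum.elim spin m) ≠ 0}.Finite ∧
        HasSum (fun m : F → ℕ => (∏ f, (-1 : ℂ) ^ m f * ((m f : ℂ) + 1)) *
            (Γ.expand v T attach).invariant (Sum.elim spin m))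
          (Γ.invariant spin)) ∧
    -- the character identity, for every continuous function: in the sense of Abel summation, and
    -- in the ordinary sense whenever the series converges
    (∀ f : SU2 × SU2 → ℂ, Continuous f →
      Filter.Tendsto
        (fun r : ℝ => ∑' n : ℕ, ((n : ℂ) + 1) *
          (∫ p, f p * SU2.chi n (p.1 * p.2⁻¹) ∂(SU2.haar.prod SU2.haar)) * (r : ℂ) ^ n)
        (nhdsWithin 1 (Set.Iio 1)) (nhds (∫ h, f (h, h) ∂SU2.haar)) ∧
      ∀ s : ℂ,
        Filter.Tendsto
          (fun N : ℕ => ∑ n ∈ Finset.range N, ((n : ℂ) + 1) *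
            ∫ p, f p * SU2.chi n (p.1 * p.2⁻¹) ∂(SU2.haar.prod SU2.haar))
          Filter.atTop (nhds s) →
        s = ∫ h, f (h, h) ∂SU2.haar) := by
  refine ⟨?_, ?_, ?_⟩
  · intro V E _ _ _ Γ e₀ hne spin
    exact Γ.contraction e₀ hne spin
  · intro V E W F _ _ _ _ Γ v T hT attach spin
    exact Γ.tree_expansion v T hT attach spin
  · intro f hf
    refine ⟨SU2.character_identity hf, fun s hs => ?_⟩
    -- Abel's limit theorem
    exact tendsto_nhds_unique
      (Filter.tendsto_map'_iff.mp (Complex.tendsto_tsum_powerSeries_nhdsWithin_lt hs))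
      (SU2.character_identity hf)
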